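/- All graphs are finite, simple and undirected. **Kemeny's constant.** For a connected graph $H$ with at least two vertices, consider the random walk on $H$ (from a vertex $i$ it moves to each neighbour of $i$ with probability $1/\deg_H(i)$). Let $w$ be its stationary distribution and let $m_{i,j}$ be the mean first passage time from $i$ to $j$. Kemeny's constant of $H$ is $\kappa(H)=\sum_{j\ne i} m_{i,j}w_j$, which does not depend on the vertex $i$. **Paradoxical graphs.** Let $G$ be a connected graph, $v\in V(G)$, and let $k_1,k_2\ge 0$ be integers with $k_1+k_2\ge 2$. Let $\widetilde G(v,k_1,k_2)$ be the graph obtained from $G$ and two disjoint paths $(v_1,\dots,v_{k_1+1})$ and $(w_1,\dots,w_{k_2+1})$ by identifying $v$, $v_1$ and $w_1$, and let $\widehat G(v,k_1,k_2)$ be obtained from $\widetilde G(v,k_1,k_2)$ by inserting the edge between $v_{k_1+1}$ and $w_{k_2+1}$. The graph $G$ is $(v,k_1,k_2)$-paradoxical if $\kappa(\widehat G(v,k_1,k_2))>\kappa(\widetilde G(v,k_1,k_2))$. A sequence $(G_n)_{n\ge 1}$ of connected graphs, $G_n$ having order $n$ and a specified vertex $v$, is asymptotically paradoxical if for all integers $k_1,k_2\ge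 0$ with $k_1+k_2\ge 2$ there is $N>0$ such that $G_n$ is $(v,k_1,k_2)$-paradoxical for all $n\ge N$. **Statement.** Let $(\mathcal T_n)_{n\ge 1}$ be a sequence of trees such that $V(\mathcal T_1)=\{v\}$ and, for each $n\ge 2$, $\mathcal T_n$ is obtained from $\mathcal T_{n-1}$ either by adding a new pendent vertex or by subdividing an edge into two edges with a new vertex; the specified vertex of every $\mathcal T_n$ is $v$. Let $\alpha_n=\max\{\mathrm{dist}_{\mathcal T_n}(v,x) : x\in V(\mathcal T_n)\}$ be the eccentricity of $v$ in $\mathcal T_n$. If $\alpha_n=\omega(n^{2/3})$, that is, $n^{2/3}=o(\alpha_n)$ as $n\to\infty$, then the sequence $(\mathcal T_n)$ with the vertex $v$ is asymptotically paradoxical. -/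

import Mathlib

open Filter Asymptotics
open scoped ENNReal NNReal

/-! ## Finite Markov chains and Kemeny's constant -/

section MarkovChain

variable {S : Type*} [Fintype S] [DecidableEq S]

/-- `firstPassageProb P j t i` is the probability `f_{ij}^{(t)}` that the Markov chain with
transition matrix `P`, started at `i`, visits the state `j` at time `t` and at no time
`1, …, t - 1`: `f_{ij}^{(1)} = p_{ij}` and `f_{ij}^{(t+1)} = ∑_{k ≠ j} p_{ik} f_{kj}^{(t)}`. -/
noncomputable def firstPassageProb (P : Matrix S S ℝ≥0) (j : S) : ℕ → S → ℝ≥0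
  | 0, _ => 0
  | 1, i => P i j
  | t + 2, i => ∑ k ∈ Finset.univ.erase j, P i k * firstPassageProb P j (t + 1) k

/-- The mean first passage time from `i` to `j`, i.e. `∑ t, t * f_{ij}^{(t)}`, the expectation of
the first time `t ≥ 1` at which the chain started at `i` is at `j`
(when `j` is reached from `i` almost surely, as in every finite irreducible chain). -/
noncomputable def meanFirstPassageTime (P : Matrix S S ℝ≥0) (i j : S) : ℝ≥0∞ :=
  ∑' t : ℕ, (t : ℝ≥0∞) * (firstPassageProb P j t i : ℝ≥0∞)

/-- `w` is a stationary distribution of the Markov chain with transition matrix `P`. -/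
def IsStationaryDistribution (P : Matrix S S ℝ≥0) (w : S → ℝ≥0) : Prop :=
  ∑ i, w i = 1 ∧ ∀ j, ∑ i, w i * P i j = w j

/-- `κ` is Kemeny's constant of the chain with transition matrix `P`: for the stationary
distribution `w`, the sum `∑_{j ≠ i} m_{ij} w_j` is equal to `κ`, whatever the state `i` is.
An irreducible chain has just one stationary distribution, so it has at most one such `κ`. -/
def IsKemenyConstant (P : Matrix S S ℝ≥0) (κ : ℝ≥0) : Prop :=
  ∃ w : S → ℝ≥0, IsStationaryDistribution P w ∧
    ∀ i, ∑ j ∈ Finset.univ.erase i, meanFirstPassageTime P i j * (w j : ℝ≥0∞) = (κ : ℝ≥0∞)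

end MarkovChain

namespace SimpleGraph

open Classical in
/-- The transition matrix of the (simple) random walk on `G`. -/
noncomputable def walkMatrix {V : Type*} [Fintype V] (G : SimpleGraph V) : Matrix V V ℝ≥0 :=
  fun i j => if G.Adj i j then (G.degree i : ℝ≥0)⁻¹ else 0

open Classical in
/-- `κ` is Kemeny's constant `κ(G)` of the random walk on `G`. -/
def IsKemenyConstant {V : Type*} [Fintype V] (G : SimpleGraph V) (κ : ℝ≥0) : Prop :=
  _root_.IsKemenyConstant G.walkMatrix κ

/-! ## Twin pendent paths -/

section TwinPaths

variable {V : Type*}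

/-- The vertices of the first pendent path in the graph with twin pendent paths at `v`:
the initial vertex is `v`, the others are new. -/
def twinPath₁ (v : V) (k₁ k₂ : ℕ) : Fin (k₁ + 1) → V ⊕ (Fin k₁ ⊕ Fin k₂) :=
  Fin.cons (Sum.inl v) fun i => Sum.inr (Sum.inl i)

/-- The vertices of the second pendent path: the initial vertex is `v`, the others are new. -/
def twinPath₂ (v : V) (k₁ k₂ : ℕ) : Fin (k₂ + 1) → V ⊕ (Fin k₁ ⊕ Fin k₂) :=
  Fin.cons (Sum.inl v) fun i => Sum.inr (Sum.inr i)

/-- The graph `G̃(v, k₁, k₂)` obtained from `G` and two paths on `k₁ + 1` and `k₂ + 1` vertices by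
identifying `v` with the initial vertices of the two paths. -/
def twinTilde (G : SimpleGraph V) (v : V) (k₁ k₂ : ℕ) : SimpleGraph (V ⊕ (Fin k₁ ⊕ Fin k₂)) :=
  G.map Sum.inl ⊔ (pathGraph (k₁ + 1)).map (twinPath₁ v k₁ k₂)
    ⊔ (pathGraph (k₂ + 1)).map (twinPath₂ v k₁ k₂)

/-- The graph `Ĝ(v, k₁, k₂)` obtained from `G̃(v, k₁, k₂)` by inserting the edge between the final
vertices of the two paths. -/
def twinHat (G : SimpleGraph V) (v : V) (k₁ k₂ : ℕ) : SimpleGraph (V ⊕ (Fin k₁ ⊕ Fin k₂)) :=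
  G.twinTilde v k₁ k₂ ⊔
    edge (twinPath₁ v k₁ k₂ (Fin.last k₁)) (twinPath₂ v k₁ k₂ (Fin.last k₂))

/-- `G` is `(v, k₁, k₂)`-paradoxical: `κ(Ĝ(v, k₁, k₂)) > κ(G̃(v, k₁, k₂))`. -/
def IsParadoxicalAt [Fintype V] (G : SimpleGraph V) (v : V) (k₁ k₂ : ℕ) : Prop :=
  ∃ a b : ℝ≥0, (G.twinHat v k₁ k₂).IsKemenyConstant a ∧
    (G.twinTilde v k₁ k₂).IsKemenyConstant b ∧ a > b

end TwinPaths

/-! ## Sequences of graphs with a specified vertex -/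

section Sequences

/-- The sequence `G 1, G 2, …` with specified vertices `v 1, v 2, …` is asymptotically
`(k₁, k₂)`-paradoxical. The entry with index `0` plays no role. -/
def AsymptoticallyParadoxicalAt {V : ℕ → Type*} [∀ n, Fintype (V n)]
    (G : ∀ n, SimpleGraph (V n)) (v : ∀ n, V n) (k₁ k₂ : ℕ) : Prop :=
  ∃ N > 0, ∀ n ≥ N, (G n).IsParadoxicalAt (v n) k₁ k₂

/-- The sequence `G 1, G 2, …` with specified vertices `v 1, v 2, …` is asymptotically
paradoxical. -/
def AsymptoticallyParadoxical {V : ℕ → Type*} [∀ n, Fintype (V n)]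
    (G : ∀ n, SimpleGraph (V n)) (v : ∀ n, V n) : Prop :=
  ∀ k₁ k₂ : ℕ, 2 ≤ k₁ + k₂ → AsymptoticallyParadoxicalAt G v k₁ k₂

variable {V W : Type*}

/-- `H` arises from `G` (whose vertices are seen in `H` through `f`) by adding one new pendent
vertex `x`, adjacent to a single vertex `a` of `G`. -/
def AddsPendentVertex (G : SimpleGraph V) (H : SimpleGraph W) (f : V ↪ W) : Prop :=
  ∃ (x : W) (a : V), (∀ y, y ∉ Set.range f ↔ y = x) ∧
    (∀ c d, H.Adj (f c) (f d) ↔ G.Adj c d) ∧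
    (∀ c, H.Adj x (f c) ↔ c = a)

/-- `H` arises from `G` (whose vertices are seen in `H` through `f`) by subdividing an edge `ab`
of `G` with one new vertex `x`. -/
def SubdividesEdge (G : SimpleGraph V) (H : SimpleGraph W) (f : V ↪ W) : Prop :=
  ∃ (x : W) (a b : V), G.Adj a b ∧ (∀ y, y ∉ Set.range f ↔ y = x) ∧
    (∀ c d, H.Adj (f c) (f d) ↔ G.Adj c d ∧ s(c, d) ≠ s(a, b)) ∧
    (∀ c, H.Adj x (f c) ↔ c = a ∨ c = b)

/-- `T 1, T 2, …` is a sequence of trees with a specified vertex `v`, starting from the one-vertex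
tree, in which every later tree is obtained from the preceding one by adding a new pendent vertex
or by subdividing an edge (so `T n` has order `n`). The specified vertex remains the same: the
inclusion of the old vertices carries `v n` to `v (n + 1)`. The entry with index `0` plays no
role. -/
structure IsGrowingTreeSequence {V : ℕ → Type*} (T : ∀ n, SimpleGraph (V n)) (v : ∀ n, V n) :
    Prop where
  isTree : ∀ n ≥ 1, (T n).IsTree
  start : ∀ x : V 1, x = v 1
  grow : ∀ n ≥ 1, ∃ f : V n ↪ V (n + 1), f (v n) = v (n + 1) ∧
    (AddsPendentVertex (T n) (T (n + 1)) f ∨ SubdividesEdge (T n) (T (n + 1)) f)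

end Sequences

end SimpleGraph

/-! For a graph H with degrees d and effective resistances R, Kemeny's constant is ∑ d_x d_y R(x,y)
/ (2 ∑ d_x) (`IsResistance.exists_isKemenyConstant`). Resistance adds across a cut vertex, equals
distance in a tree, and is explicit in a path and in a cycle. So both constants are explicit for a
tree T glued at v to a path or to a cycle (`IsTwinGluing.exists_isKemenyConstant`).

Put M = ∑ d_a, μ = ∑ d_a dist(a,v), F = ∑ d_a d_b dist(a,b) over T, and let p < q be the degree sums
of the path and of the cycle. Cross-multiplying the two quotients, the T-dependent main terms
combine to (q - p)(2Mμ - F). The only negative contribution comes from the path's own resistances,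
and it is O(n²) for fixed k₁, k₂ (`kemeny_quotient_lt`).

Now 2Mμ - F is the sum of d_a d_b (dist(a,v) + dist(b,v) - dist(a,b)). Its terms are nonnegative,
and on a geodesic of length α leaving v they are at least 2 min(s,t). Hence it is at least (2/3)α³
(`Connected.cube_dist_le_sum_gromov`). Inserting the edge therefore raises Kemeny's constant once α³
exceeds a constant multiple of n², which is what n^(2/3) = o(α) provides. -/

/-! ### First-step analysis of passage times -/

section KilledChain

variable {S : Type*} [Fintype S] [DecidableEq S]

/-- One step of the chain with transition matrix `P`, killed on arriving at `j`, acting on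
functions. -/
noncomputable def killedStep (P : Matrix S S ℝ≥0) (j : S) (g : S → ℝ) (i : S) : ℝ :=
  ∑ k ∈ Finset.univ.erase j, (P i k : ℝ) * g k

lemma killedStep_mono (P : Matrix S S ℝ≥0) (j : S) : Monotone (killedStep P j) := by
  intro g g' h i
  exact Finset.sum_le_sum fun k _ => mul_le_mul_of_nonneg_left (h k) (P i k).coe_nonneg

lemma killedStep_sub (P : Matrix S S ℝ≥0) (j : S) (g g' : S → ℝ) :
    killedStep P j (g - g') = killedStep P j g - killedStep P j g' := by
  funext i
  simp [killedStep, mul_sub, Finset.sum_sub_distrib]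

lemma killedStep_smul (P : Matrix S S ℝ≥0) (j : S) (c : ℝ) (g : S → ℝ) :
    killedStep P j (c • g) = c • killedStep P j g := by
  funext i
  simp only [killedStep, Pi.smul_apply, smul_eq_mul, Finset.mul_sum]
  exact Finset.sum_congr rfl fun k _ => by ring

/-- The `t`-th iterate on `1` is the probability of avoiding `j` at times `1, …, t`; a first visit
at time `t + 1` is a drop in this survival probability. -/
lemma firstPassageProb_succ_eq (P : Matrix S S ℝ≥0) (hP : ∀ i, ∑ k, P i k = 1) (j : S) (t : ℕ) :
    (fun i => (firstPassageProb P j (t + 1) i : ℝ)) =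
      (killedStep P j)^[t] 1 - (killedStep P j)^[t + 1] 1 := by
  induction t with
  | zero =>
    funext i
    have h : (∑ k, (P i k : ℝ)) = 1 := by exact_mod_cast congrArg NNReal.toReal (hP i)
    rw [← Finset.add_sum_erase _ _ (Finset.mem_univ j)] at h
    simp only [firstPassageProb, killedStep, Pi.sub_apply, Pi.one_apply, Function.iterate_succ,
      Function.iterate_zero, Function.comp, id, mul_one]
    linarith
  | succ t ih =>
    rw [Function.iterate_succ_apply', Function.iterate_succ_apply' _ (t + 1), ← killedStep_sub,
      ← ih]
    funext i
    simp [firstPassageProb, killedStep]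

/-- Summation by parts: a truncated expectation is a sum of survival probabilities minus a boundary
term. -/
lemma sum_range_mul_firstPassageProb (P : Matrix S S ℝ≥0) (hP : ∀ i, ∑ k, P i k = 1) (j i : S)
    (N : ℕ) :
    ∑ t ∈ Finset.range (N + 1), (t : ℝ) * (firstPassageProb P j t i : ℝ) =
      ∑ t ∈ Finset.range N, (killedStep P j)^[t] 1 i - N * (killedStep P j)^[N] 1 i := by
  induction N with
  | zero => simp
  | succ N ih =>
    rw [Finset.sum_range_succ, ih, Finset.sum_range_succ]
    have := congrFun (firstPassageProb_succ_eq P hP j N) i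
    simp only [Pi.sub_apply] at this
    rw [this]
    push_cast
    ring

/-- The sum telescopes, because `1` is `h` minus its killed step. -/
lemma sum_range_killedStep_iterate (P : Matrix S S ℝ≥0) (j : S) (h : S → ℝ)
    (hh : h = 1 + killedStep P j h) (N : ℕ) :
    ∑ t ∈ Finset.range N, (killedStep P j)^[t] 1 = h - (killedStep P j)^[N] h := by
  have hsub : ∀ (t : ℕ) (g g' : S → ℝ), (killedStep P j)^[t] (g - g') =
      (killedStep P j)^[t] g - (killedStep P j)^[t] g' := by
    intro t
    induction t with
    | zero => simp
    | succ t ih => intro g g'; simp [killedStep_sub, ih]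
  induction N with
  | zero => simp
  | succ N ih =>
    have h1 : (1 : S → ℝ) = h - killedStep P j h := by
      nth_rewrite 1 [hh]; simp
    rw [Finset.sum_range_succ, ih, Function.iterate_succ_apply]
    have h2 : (killedStep P j)^[N] 1 =
        (killedStep P j)^[N] h - (killedStep P j)^[N] (killedStep P j h) := by
      rw [← hsub, ← h1]
    rw [h2]
    abel

/-- A nonnegative solution of the first-step equations is the mean first passage time. -/
theorem meanFirstPassageTime_eq_ofReal (P : Matrix S S ℝ≥0) (hP : ∀ i, ∑ k, P i k = 1) (j : S)
    (h : S → ℝ) (hnonneg : 0 ≤ h) (hh : h = 1 + killedStep P j h) (i : S) :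
    meanFirstPassageTime P i j = ENNReal.ofReal (h i) := by
  have hone : (1 : S → ℝ) ≤ h := by
    have := killedStep_mono P j hnonneg
    have h0 : killedStep P j 0 = 0 := by funext i; simp [killedStep]
    rw [h0] at this
    rw [hh]
    exact le_add_of_nonneg_right this
  set H := ∑ k, h k with hH
  have hle : ∀ k, h k ≤ H := fun k =>
    Finset.single_le_sum (f := h) (fun k _ => hnonneg k) (Finset.mem_univ k)
  have hHpos : 0 < H := lt_of_lt_of_le (lt_of_lt_of_le one_pos (hone i)) (hle i)
  have hH1 : 1 ≤ H := (hone i).trans (hle i)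
  -- As `1 ≤ h ≤ H`, a killed step sends `h` to `h - 1 ≤ (1 - 1/H) h`. Survival probabilities thus
  -- decay geometrically, which kills both boundary terms below.
  set ρ := 1 - H⁻¹ with hρ
  have hρ0 : 0 ≤ ρ := by
    have := inv_le_one_of_one_le₀ hH1
    linarith
  have hρ1 : ρ < 1 := by
    have := inv_pos.mpr hHpos
    linarith
  have hstep : killedStep P j h ≤ ρ • h := by
    intro k
    have h1 : h k = 1 + killedStep P j h k := congrFun hh k
    have h2 : H⁻¹ * h k ≤ 1 := by
      rw [inv_mul_le_iff₀ hHpos, mul_one]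
      exact hle k
    simp only [Pi.smul_apply, smul_eq_mul, hρ]
    linarith
  have hdecay : ∀ N, (killedStep P j)^[N] h ≤ ρ ^ N • h := by
    intro N
    induction N with
    | zero => simp
    | succ N ih =>
      rw [Function.iterate_succ_apply']
      calc killedStep P j ((killedStep P j)^[N] h) ≤ killedStep P j (ρ ^ N • h) :=
            killedStep_mono P j ih
        _ = ρ ^ N • killedStep P j h := killedStep_smul P j _ _
        _ ≤ ρ ^ N • (ρ • h) := smul_le_smul_of_nonneg_left hstep (pow_nonneg hρ0 N)
        _ = ρ ^ (N + 1) • h := by rw [smul_smul, pow_succ]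
  have hnn : ∀ (N : ℕ) (g : S → ℝ), 0 ≤ g → 0 ≤ (killedStep P j)^[N] g := by
    intro N
    induction N with
    | zero => intro g hg; simpa using hg
    | succ N ih =>
      intro g hg
      rw [Function.iterate_succ_apply]
      refine ih _ fun k => Finset.sum_nonneg fun l _ => mul_nonneg (P k l).coe_nonneg (hg l)
  have hu : ∀ N, (killedStep P j)^[N] 1 i ≤ ρ ^ N * h i := fun N =>
    ((killedStep_mono P j).iterate N hone i).trans (hdecay N i)
  have hpow : Tendsto (fun N : ℕ => ρ ^ N * h i) atTop (nhds 0) := by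
    simpa using (tendsto_pow_atTop_nhds_zero_of_lt_one hρ0 hρ1).mul_const (h i)
  have hlim1 : Tendsto (fun N : ℕ => (killedStep P j)^[N] h i) atTop (nhds 0) :=
    squeeze_zero (fun N => hnn N h hnonneg i) (fun N => hdecay N i) hpow
  have hlim2 : Tendsto (fun N : ℕ => (N : ℝ) * (killedStep P j)^[N] 1 i) atTop (nhds 0) := by
    refine squeeze_zero (fun N => mul_nonneg N.cast_nonneg (hnn N 1 zero_le_one i))
      (fun N => mul_le_mul_of_nonneg_left (hu N) N.cast_nonneg) ?_
    have := (tendsto_self_mul_const_pow_of_lt_one hρ0 hρ1).mul_const (h i)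
    simpa [mul_assoc] using this
  have hpart : ∀ N : ℕ, ∑ t ∈ Finset.range (N + 1), (t : ℝ) * (firstPassageProb P j t i : ℝ) =
      h i - (killedStep P j)^[N] h i - N * (killedStep P j)^[N] 1 i := by
    intro N
    rw [sum_range_mul_firstPassageProb P hP]
    have := congrFun (sum_range_killedStep_iterate P j h hh N) i
    simp only [Finset.sum_apply, Pi.sub_apply] at this
    rw [this]
  have hlim : Tendsto (fun N : ℕ =>
      ∑ t ∈ Finset.range N, (t : ℝ) * (firstPassageProb P j t i : ℝ)) atTop (nhds (h i)) := by
    rw [← tendsto_add_atTop_iff_nat 1]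
    simp only [hpart]
    simpa using (tendsto_const_nhds.sub hlim1).sub hlim2
  have hterm : ∀ t : ℕ, 0 ≤ (t : ℝ) * (firstPassageProb P j t i : ℝ) := fun t => by positivity
  have hsum : HasSum (fun t : ℕ => (t : ℝ) * (firstPassageProb P j t i : ℝ)) (h i) :=
    (hasSum_iff_tendsto_nat_of_nonneg hterm _).mpr hlim
  rw [meanFirstPassageTime, ← hsum.tsum_eq, ENNReal.ofReal_tsum_of_nonneg hterm hsum.summable]
  refine tsum_congr fun t => ?_
  rw [ENNReal.ofReal_mul t.cast_nonneg]
  simp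

end KilledChain

namespace SimpleGraph

/-! ### Hitting times and Kemeny's constant from resistances -/

section Resistance

open Classical in
/-- The potential-theoretic expression for the mean time in which the walk on `G` started at `i`
reaches `j`, in terms of a resistance function `R`. -/
noncomputable def resistanceHittingTime {W : Type*} [Fintype W] (G : SimpleGraph W)
    (R : W → W → ℝ) (j i : W) : ℝ :=
  (1 / 2) * ∑ k, (G.degree k : ℝ) * (R i j + R j k - R i k)

open Classical in
/-- `R` satisfies the Laplace equations characterising effective resistance. -/
def IsResistance {W : Type*} [Fintype W] (G : SimpleGraph W) (R : W → W → ℝ) : Prop :=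
  (∀ x, R x x = 0) ∧ ∃ a : W → ℝ, ∀ i x,
    ∑ k, (if G.Adj i k then R i x - R k x else 0) = a i - 2 * (if i = x then 1 else 0)

variable {W : Type*} [Fintype W] {G : SimpleGraph W} {R : W → W → ℝ}

-- The unknown `a i` is the same for every second argument, so it cancels in the differences; only
-- the point masses at `l` and `j` survive the degree-weighted sum.
open Classical in
lemma IsResistance.sum_hittingTime_sub (hR : G.IsResistance R) (i j : W) :
    ∑ k, (if G.Adj i k then resistanceHittingTime G R j i - resistanceHittingTime G R j k else 0) =
      G.degree i - (if i = j then 1 else 0) * ∑ k, (G.degree k : ℝ) := by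
  obtain ⟨a, ha⟩ := hR.2
  have hkey : ∀ k, (if G.Adj i k then
      resistanceHittingTime G R j i - resistanceHittingTime G R j k else 0) =
      (1 / 2) * ∑ l, (G.degree l : ℝ) * ((if G.Adj i k then R i j - R k j else 0) -
        (if G.Adj i k then R i l - R k l else 0)) := by
    intro k
    split_ifs
    · rw [resistanceHittingTime, resistanceHittingTime, ← mul_sub, ← Finset.sum_sub_distrib]
      congr 1
      exact Finset.sum_congr rfl fun l _ => by ring
    · simp
  simp_rw [hkey]
  rw [← Finset.mul_sum, Finset.sum_comm]
  simp_rw [← Finset.mul_sum, Finset.sum_sub_distrib, ha]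
  have h1 : ∀ l, (G.degree l : ℝ) * (a i - 2 * (if i = j then 1 else 0) -
      (a i - 2 * (if i = l then 1 else 0))) =
      2 * ((if i = l then (G.degree l : ℝ) else 0) - (if i = j then 1 else 0) * G.degree l) := by
    intro l
    split_ifs <;> ring
  simp_rw [h1]
  rw [← Finset.mul_sum, Finset.sum_sub_distrib, ← Finset.mul_sum]
  simp

lemma IsResistance.hittingTime_self (hR : G.IsResistance R) (j : W) :
    resistanceHittingTime G R j j = 0 := by
  simp [resistanceHittingTime, hR.1]

open Classical in
lemma sum_adj_const (i : W) (c : ℝ) : ∑ k, (if G.Adj i k then c else 0) = G.degree i * c := by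
  rw [← Finset.sum_filter, Finset.sum_const, nsmul_eq_mul, ← card_neighborFinset_eq_degree]
  congr 3
  ext k
  simp

open Classical in
lemma sum_walkMatrix_mul (i : W) (g : W → ℝ) :
    ∑ k, (G.walkMatrix i k : ℝ) * g k =
      (G.degree i : ℝ)⁻¹ * ∑ k, (if G.Adj i k then g k else 0) := by
  rw [Finset.mul_sum]
  refine Finset.sum_congr rfl fun k _ => ?_
  unfold walkMatrix
  split_ifs <;> simp

open Classical in
lemma IsResistance.hittingTime_eq (hR : G.IsResistance R) (hd : ∀ i, 0 < G.degree i) {i j : W}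
    (hij : i ≠ j) : resistanceHittingTime G R j i =
      1 + ∑ k, (G.walkMatrix i k : ℝ) * resistanceHittingTime G R j k := by
  have h := hR.sum_hittingTime_sub i j
  have h2 : ∑ k, (if G.Adj i k then
      resistanceHittingTime G R j i - resistanceHittingTime G R j k else 0) =
      G.degree i * resistanceHittingTime G R j i -
        ∑ k, (if G.Adj i k then resistanceHittingTime G R j k else 0) := by
    rw [← sum_adj_const, ← Finset.sum_sub_distrib]
    refine Finset.sum_congr rfl fun k _ => ?_
    split_ifs <;> simp
  rw [h2, if_neg hij] at h
  have hdi : (G.degree i : ℝ) ≠ 0 := by exact_mod_cast (hd i).ne'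
  rw [sum_walkMatrix_mul]
  field_simp
  linarith

open Classical in
lemma sum_walkMatrix_row (hd : ∀ i, 0 < G.degree i) (i : W) : ∑ k, G.walkMatrix i k = 1 := by
  have h := sum_walkMatrix_mul (G := G) i 1
  simp only [Pi.one_apply, mul_one, sum_adj_const] at h
  have hdi : (G.degree i : ℝ) ≠ 0 := by exact_mod_cast (hd i).ne'
  rw [inv_mul_cancel₀ hdi] at h
  exact_mod_cast h

-- Minimum principle: at a minimiser other than `j` the value would be at least one more than
-- itself.
open Classical in
lemma IsResistance.hittingTime_nonneg (hR : G.IsResistance R) (hd : ∀ i, 0 < G.degree i) (j : W) :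
    0 ≤ resistanceHittingTime G R j := by
  obtain ⟨i, -, hi⟩ := Finset.exists_min_image Finset.univ (resistanceHittingTime G R j)
    ⟨j, Finset.mem_univ j⟩
  by_cases hij : i = j
  · subst hij
    intro k
    simpa [hR.hittingTime_self] using hi k (Finset.mem_univ k)
  · exfalso
    have h := hR.hittingTime_eq hd hij
    have h1 : ∑ k, (G.walkMatrix i k : ℝ) * resistanceHittingTime G R j i ≤
        ∑ k, (G.walkMatrix i k : ℝ) * resistanceHittingTime G R j k :=
      Finset.sum_le_sum fun k _ =>
        mul_le_mul_of_nonneg_left (hi k (Finset.mem_univ k)) (G.walkMatrix i k).coe_nonneg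
    have h2 : ∑ k, (G.walkMatrix i k : ℝ) = 1 := by
      exact_mod_cast congrArg NNReal.toReal (sum_walkMatrix_row hd i)
    rw [← Finset.sum_mul, h2] at h1
    linarith

open Classical in
lemma IsResistance.meanFirstPassageTime_eq (hR : G.IsResistance R) (hd : ∀ i, 0 < G.degree i)
    {i j : W} (hij : i ≠ j) :
    meanFirstPassageTime G.walkMatrix i j = ENNReal.ofReal (resistanceHittingTime G R j i) := by
  set h := resistanceHittingTime G R j with hdef
  have hkill : ∀ g : W → ℝ, g j = 0 → ∀ k, killedStep G.walkMatrix j g k =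
      ∑ l, (G.walkMatrix k l : ℝ) * g l := by
    intro g hg k
    rw [killedStep, ← Finset.add_sum_erase _ _ (Finset.mem_univ j), hg]
    simp
  -- The first-step equation is also required at `j`, where it describes the return time while the
  -- hitting time is `0`. The value at `j` is replaced accordingly; the killed step never reads it.
  have hupd : killedStep G.walkMatrix j (Function.update h j (1 + killedStep G.walkMatrix j h j)) =
      killedStep G.walkMatrix j h := by
    funext k
    refine Finset.sum_congr rfl fun l hl => ?_
    rw [Function.update_of_ne (Finset.ne_of_mem_erase hl)]
  have hnn : 0 ≤ h := hR.hittingTime_nonneg hd j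
  have := meanFirstPassageTime_eq_ofReal G.walkMatrix (sum_walkMatrix_row hd) j
    (Function.update h j (1 + killedStep G.walkMatrix j h j)) ?_ ?_ i
  · rwa [Function.update_of_ne hij] at this
  · intro k
    by_cases hk : k = j
    · subst hk
      rw [Function.update_self]
      exact add_nonneg zero_le_one
        (Finset.sum_nonneg fun l _ => mul_nonneg (NNReal.coe_nonneg _) (hnn l))
    · rw [Function.update_of_ne hk]
      exact hnn k
  · rw [hupd]
    funext k
    by_cases hk : k = j
    · subst hk
      simp
    · rw [Function.update_of_ne hk, Pi.add_apply, hkill h (hR.hittingTime_self j)]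
      exact hR.hittingTime_eq hd hk

open Classical in
/-- Kemeny's constant in terms of a resistance function. -/
theorem IsResistance.exists_isKemenyConstant [Nonempty W] (hR : G.IsResistance R)
    (hd : ∀ i, 0 < G.degree i) :
    ∃ κ : ℝ≥0, G.IsKemenyConstant κ ∧
      (κ : ℝ) = (∑ x, ∑ y, (G.degree x : ℝ) * G.degree y * R x y) /
        (2 * ∑ x, (G.degree x : ℝ)) := by
  set M : ℝ≥0 := ∑ x, (G.degree x : ℝ≥0) with hM
  have hMpos : 0 < M := by
    refine Finset.sum_pos (fun x _ => ?_) Finset.univ_nonempty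
    exact_mod_cast hd x
  have hMR : (M : ℝ) = ∑ x, (G.degree x : ℝ) := by simp [hM]
  have hMR0 : (∑ x, (G.degree x : ℝ)) ≠ 0 := by
    rw [← hMR]; exact_mod_cast hMpos.ne'
  set K : ℝ := (∑ x, ∑ y, (G.degree x : ℝ) * G.degree y * R x y) /
        (2 * ∑ x, (G.degree x : ℝ)) with hK
  -- With weights `deg j / M`, the two sums involving `i` are equal and cancel, leaving a value
  -- independent of the starting state.
  have hsum : ∀ i, ∑ j, resistanceHittingTime G R j i * ((G.degree j : ℝ) / M) = K := by
    intro i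
    have h1 : ∀ j, resistanceHittingTime G R j i * ((G.degree j : ℝ) / M) =
        (1 / (2 * M)) * (∑ k, ((G.degree j : ℝ) * R i j) * G.degree k +
          ∑ k, (G.degree j : ℝ) * G.degree k * R j k -
          ∑ k, (G.degree j : ℝ) * (G.degree k * R i k)) := by
      intro j
      rw [← Finset.sum_add_distrib, ← Finset.sum_sub_distrib, resistanceHittingTime, Finset.mul_sum,
        Finset.sum_mul, Finset.mul_sum]
      refine Finset.sum_congr rfl fun k _ => ?_
      have : (M : ℝ) ≠ 0 := by exact_mod_cast hMpos.ne'
      field_simp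
    simp_rw [h1]
    rw [← Finset.mul_sum, Finset.sum_sub_distrib, Finset.sum_add_distrib]
    simp_rw [← Finset.mul_sum]
    rw [← Finset.sum_mul, ← Finset.sum_mul, hMR, hK]
    field_simp
    ring
  have hnn : ∀ i j, 0 ≤ resistanceHittingTime G R j i := fun i j => hR.hittingTime_nonneg hd j i
  have hK0 : 0 ≤ K := by
    obtain ⟨i⟩ := ‹Nonempty W›
    rw [← hsum i]
    exact Finset.sum_nonneg fun j _ => mul_nonneg (hnn i j) (by positivity)
  refine ⟨⟨K, hK0⟩, ⟨fun x => G.degree x / M, ⟨?_, fun j => ?_⟩, fun i => ?_⟩, rfl⟩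
  · rw [← Finset.sum_div, ← hM, div_self hMpos.ne']
  · have h1 : ∀ i, (G.degree i : ℝ≥0) / M * G.walkMatrix i j =
        (if G.Adj j i then 1 else 0) / M := by
      intro i
      have hdi : (G.degree i : ℝ≥0) ≠ 0 := by exact_mod_cast (hd i).ne'
      unfold walkMatrix
      simp only [G.adj_comm i j]
      split_ifs
      · field_simp
      · simp
    simp_rw [h1]
    rw [← Finset.sum_div]
    congr 1
    have := sum_adj_const (G := G) j 1
    rw [mul_one] at this
    have h3 : ((∑ i, (if G.Adj j i then 1 else 0) : ℝ≥0) : ℝ) = (G.degree j : ℝ) := by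
      
      rw [← this]
      rw [NNReal.coe_sum]
      exact Finset.sum_congr rfl fun i _ => by split_ifs <;> simp
    exact_mod_cast h3
  · have h1 : ∀ j ∈ Finset.univ.erase i, meanFirstPassageTime G.walkMatrix i j *
        (((G.degree j : ℝ≥0) / M : ℝ≥0) : ℝ≥0∞) =
        ENNReal.ofReal (resistanceHittingTime G R j i * ((G.degree j : ℝ) / M)) := by
      intro j hj
      rw [hR.meanFirstPassageTime_eq hd (Finset.ne_of_mem_erase hj).symm,
        ENNReal.ofReal_mul (hnn i j), ← ENNReal.ofReal_coe_nnreal]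
      simp
    rw [Finset.sum_congr rfl h1, ← ENNReal.ofReal_sum_of_nonneg
      (fun j _ => mul_nonneg (hnn i j) (by positivity))]
    have h2 := hsum i
    rw [← Finset.add_sum_erase _ _ (Finset.mem_univ i), hR.hittingTime_self, zero_mul, zero_add]
      at h2
    rw [h2]
    exact ENNReal.ofReal_eq_coe_nnreal hK0

end Resistance

end SimpleGraph

namespace SimpleGraph

/-! ### Resistance in a tree -/

section TreeDistance

variable {V : Type*} {T : SimpleGraph V}

/-- A neighbour closer to `x` begins a geodesic from `i` to `x`, and paths in a tree are unique. -/
lemma IsTree.existsUnique_adj_dist (hT : T.IsTree) {i x : V} (hix : i ≠ x) :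
    ∃ k, T.Adj i k ∧ T.dist k x + 1 = T.dist i x ∧
      ∀ l, T.Adj i l → T.dist l x + 1 = T.dist i x → l = k := by
  obtain ⟨p, hp, hlen⟩ := hT.connected.exists_path_of_dist i x
  cases p with
  | nil => exact absurd rfl hix
  | @cons _ k _ h q =>
    rw [Walk.length_cons] at hlen
    have hq : T.dist k x + 1 = T.dist i x := by
      have h1 := T.dist_le q
      have h2 := hT.connected.dist_triangle (u := i) (v := k) (w := x)
      rw [dist_eq_one_iff_adj.mpr h] at h2
      omega
    refine ⟨k, h, hq, fun l hl hlx => ?_⟩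
    obtain ⟨r, -, hr⟩ := hT.connected.exists_path_of_dist l x
    have hpath : (Walk.cons hl r).IsPath :=
      Walk.isPath_of_length_eq_dist _ (by rw [Walk.length_cons, hr, hlx])
    have := (hT.existsUnique_path i x).unique hpath hp
    simpa using congrArg Walk.snd this

open Classical in
/-- In a tree the effective resistance is the distance. -/
theorem IsTree.isResistance_dist [Fintype V] (hT : T.IsTree) :
    T.IsResistance fun x y => (T.dist x y : ℝ) := by
  -- For `i ≠ x`, one neighbour contributes `+1` and the others `-1`; for `i = x` all contribute
  -- `-1`.
  refine ⟨fun x => by simp, fun i => 2 - T.degree i, fun i x => ?_⟩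
  by_cases hix : i = x
  · subst hix
    have h1 : ∀ k, (if T.Adj i k then (T.dist i i : ℝ) - T.dist k i else 0) =
        if T.Adj i k then -1 else 0 := by
      intro k
      split_ifs with h
      · rw [dist_self, dist_eq_one_iff_adj.mpr h.symm]; simp
      · rfl
    simp_rw [h1]
    rw [sum_adj_const]
    simp
  · obtain ⟨k₀, hk₀, hd, huniq⟩ := hT.existsUnique_adj_dist hix
    have h1 : ∀ k, (if T.Adj i k then (T.dist i x : ℝ) - T.dist k x else 0) =
        (if T.Adj i k then -1 else 0) + if k₀ = k then 2 else 0 := by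
      intro k
      by_cases hk : k₀ = k
      · subst hk
        rw [if_pos hk₀, if_pos hk₀, if_pos rfl, ← hd]
        push_cast
        ring
      · rw [if_neg hk]
        split_ifs with h
        · have h2 := hT.dist_eq_dist_add_one_of_adj x h
          rw [T.dist_comm (u := x), T.dist_comm (u := x)] at h2
          rcases h2 with h2 | h2
          · exact absurd (huniq k h h2.symm).symm hk
          · rw [h2]; push_cast; ring
        · simp
    simp_rw [h1]
    rw [Finset.sum_add_distrib, sum_adj_const]
    simp [hix]
    ring

end TreeDistance

/-! ### Gluing at a cut vertex -/

section Gluing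

variable {V : Type*} {k₁ k₂ : ℕ}

/-- The retraction onto the base graph, sending all the new vertices to `v`. -/
def twinBase (v : V) : V ⊕ (Fin k₁ ⊕ Fin k₂) → V :=
  Sum.elim id fun _ => v

/-- The signed position of a vertex along the two pendent paths. -/
def twinCoord : V ⊕ (Fin k₁ ⊕ Fin k₂) → ℤ :=
  Sum.elim (fun _ => 0) (Sum.elim (fun i => -((i : ℤ) + 1)) fun j => (j : ℤ) + 1)

lemma twinCoord_mem (x : V ⊕ (Fin k₁ ⊕ Fin k₂)) :
    twinCoord x ∈ Finset.Icc (-(k₁ : ℤ)) k₂ := by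
  rcases x with a | i | j <;> simp [twinCoord] <;> omega

lemma eq_of_twinBase_of_twinCoord {v : V} {x y : V ⊕ (Fin k₁ ⊕ Fin k₂)}
    (hb : twinBase v x = twinBase v y) (hc : twinCoord x = twinCoord y) : x = y := by
  rcases x with a | i | j <;> rcases y with a' | i' | j' <;>
    simp [twinBase, twinCoord, Fin.ext_iff] at hb hc ⊢ <;> omega

lemma exists_twinCoord_eq (v : V) {t : ℤ} (ht : t ∈ Finset.Icc (-(k₁ : ℤ)) k₂) :
    ∃ x : V ⊕ (Fin k₁ ⊕ Fin k₂), twinBase v x = v ∧ twinCoord x = t := by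
  rw [Finset.mem_Icc] at ht
  rcases lt_trichotomy t 0 with h | h | h
  · refine ⟨Sum.inr (Sum.inl ⟨(-t - 1).toNat, by omega⟩), rfl, ?_⟩
    simp [twinCoord]; omega
  · exact ⟨Sum.inl v, rfl, h.symm⟩
  · refine ⟨Sum.inr (Sum.inr ⟨(t - 1).toNat, by omega⟩), rfl, ?_⟩
    simp [twinCoord]; omega

-- The fibre of `twinBase` over `v` is in bijection with the interval through `twinCoord`.
open Classical in
lemma sum_twinCoord [Fintype V] (v : V) (ψ : ℤ → ℝ) :
    ∑ x : V ⊕ (Fin k₁ ⊕ Fin k₂), (if twinBase v x = v then ψ (twinCoord x) else 0) =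
      ∑ t ∈ Finset.Icc (-(k₁ : ℤ)) k₂, ψ t := by
  rw [← Finset.sum_filter]
  refine Finset.sum_nbij twinCoord (fun x _ => twinCoord_mem x) ?_ ?_ fun _ _ => rfl
  · intro x hx y hy h
    simp only [Finset.coe_filter, Finset.mem_univ, true_and, Set.mem_ofPred_eq] at hx hy
    exact eq_of_twinBase_of_twinCoord (hx.trans hy.symm) h
  · intro t ht
    obtain ⟨x, hx, hxt⟩ := exists_twinCoord_eq v ht
    exact ⟨x, by simpa using hx, hxt⟩

/-- `H` consists of `T` and of a graph on the integer interval `[-k₁, k₂]` with adjacency `A`,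
glued by identifying `v` with `0`. -/
def IsTwinGluing (H : SimpleGraph (V ⊕ (Fin k₁ ⊕ Fin k₂))) (T : SimpleGraph V) (v : V)
    (A : ℤ → ℤ → Prop) : Prop :=
  ∀ x y, H.Adj x y ↔ (∃ a b, x = Sum.inl a ∧ y = Sum.inl b ∧ T.Adj a b) ∨
    (twinBase v x = v ∧ twinBase v y = v ∧ A (twinCoord x) (twinCoord y))

open Classical in
/-- The degree of `s` in the graph on `[-k₁, k₂]` with adjacency `A`. -/
noncomputable def intervalDegree (k₁ k₂ : ℕ) (A : ℤ → ℤ → Prop) (s : ℤ) : ℝ :=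
  ∑ t ∈ Finset.Icc (-(k₁ : ℤ)) k₂, if A s t then 1 else 0

open Classical in
/-- `g` is a resistance function of the graph on `[-k₁, k₂]` with adjacency `A`. -/
def IsIntervalResistance (k₁ k₂ : ℕ) (A : ℤ → ℤ → Prop) (g : ℤ → ℤ → ℝ) : Prop :=
  (∀ s, g s s = 0) ∧ ∃ a : ℤ → ℝ, ∀ s ∈ Finset.Icc (-(k₁ : ℤ)) k₂,
    ∀ z ∈ Finset.Icc (-(k₁ : ℤ)) k₂,
    ∑ t ∈ Finset.Icc (-(k₁ : ℤ)) k₂, (if A s t then g s z - g t z else 0) =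
      a s - 2 * if s = z then 1 else 0

variable [Fintype V] {H : SimpleGraph (V ⊕ (Fin k₁ ⊕ Fin k₂))} {T : SimpleGraph V} {v : V}
  {A : ℤ → ℤ → Prop} {g : ℤ → ℤ → ℝ}

-- Edges split into those of `T` and those of the interval. No edge is counted twice: vertices of
-- `T` all have coordinate `0`, and `A` has no loops.
open Classical in
lemma IsTwinGluing.sum_adj (hH : IsTwinGluing H T v A) (hA : ∀ s, ¬ A s s)
    (x : V ⊕ (Fin k₁ ⊕ Fin k₂)) (φ : V ⊕ (Fin k₁ ⊕ Fin k₂) → ℝ) :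
    ∑ y, (if H.Adj x y then φ y else 0) =
      (Sum.elim (fun a => ∑ b, if T.Adj a b then φ (Sum.inl b) else 0) (fun _ => 0) x) +
        if twinBase v x = v then
          ∑ y, (if twinBase v y = v then (if A (twinCoord x) (twinCoord y) then φ y else 0) else 0)
        else 0 := by
  have h1 : ∀ y, (if H.Adj x y then φ y else 0) =
      (if ∃ a b, x = Sum.inl a ∧ y = Sum.inl b ∧ T.Adj a b then φ y else 0) +
      if twinBase v x = v then
        (if twinBase v y = v then (if A (twinCoord x) (twinCoord y) then φ y else 0) else 0)
      else 0 := by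
    intro y
    rw [hH x y]
    by_cases h : ∃ a b, x = Sum.inl a ∧ y = Sum.inl b ∧ T.Adj a b
    · have hn : ¬ A (twinCoord x) (twinCoord y) := by
        obtain ⟨a, b, rfl, rfl, -⟩ := h
        exact hA 0
      rw [if_pos (Or.inl h), if_pos h, if_neg hn]
      simp
    · rw [if_neg h]
      simp only [h, false_or, zero_add]
      split_ifs <;> simp_all
  simp_rw [h1]
  rw [Finset.sum_add_distrib]
  congr 1
  · rcases x with a | x
    · simp [Fintype.sum_sum_type]
    · simp
  · split_ifs <;> simp

open Classical in
lemma IsTwinGluing.degree_eq (hH : IsTwinGluing H T v A) (hA : ∀ s, ¬ A s s)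
    (x : V ⊕ (Fin k₁ ⊕ Fin k₂)) :
    (H.degree x : ℝ) = (Sum.elim (fun a => (T.degree a : ℝ)) (fun _ => 0) x) +
      if twinBase v x = v then intervalDegree k₁ k₂ A (twinCoord x) else 0 := by
  have h := hH.sum_adj hA x fun _ => 1
  rw [sum_adj_const, mul_one, sum_twinCoord v fun t => if A (twinCoord x) t then 1 else 0] at h
  rw [h]
  simp_rw [sum_adj_const, mul_one]
  rfl

open Classical in
lemma IsTwinGluing.sum_degree_mul (hH : IsTwinGluing H T v A) (hA : ∀ s, ¬ A s s)
    (Φ : V ⊕ (Fin k₁ ⊕ Fin k₂) → ℝ) :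
    ∑ x, (H.degree x : ℝ) * Φ x = ∑ a, (T.degree a : ℝ) * Φ (Sum.inl a) +
      ∑ x, if twinBase v x = v then intervalDegree k₁ k₂ A (twinCoord x) * Φ x else 0 := by
  have h1 : ∀ x, (H.degree x : ℝ) * Φ x =
      (Sum.elim (fun a => (T.degree a : ℝ)) (fun _ => 0) x) * Φ x +
        if twinBase v x = v then intervalDegree k₁ k₂ A (twinCoord x) * Φ x else 0 := by
    intro x
    rw [hH.degree_eq hA, add_mul]
    split_ifs <;> simp
  simp_rw [h1]
  rw [Finset.sum_add_distrib]
  congr 1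
  simp [Fintype.sum_sum_type]

open Classical in
lemma IsTwinGluing.sum_degree_mul_base (hH : IsTwinGluing H T v A) (hA : ∀ s, ¬ A s s)
    (ψ : V → ℝ) :
    ∑ x, (H.degree x : ℝ) * ψ (twinBase v x) = ∑ a, (T.degree a : ℝ) * ψ a +
      (∑ t ∈ Finset.Icc (-(k₁ : ℤ)) k₂, intervalDegree k₁ k₂ A t) * ψ v := by
  rw [hH.sum_degree_mul hA, Finset.sum_mul, ← sum_twinCoord v]
  congr 1
  refine Finset.sum_congr rfl fun x _ => ?_
  split_ifs with h
  · rw [h]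
  · rfl

open Classical in
lemma IsTwinGluing.sum_degree_mul_coord (hH : IsTwinGluing H T v A) (hA : ∀ s, ¬ A s s)
    (ψ : ℤ → ℝ) :
    ∑ x, (H.degree x : ℝ) * ψ (twinCoord x) = (∑ a, (T.degree a : ℝ)) * ψ 0 +
      ∑ t ∈ Finset.Icc (-(k₁ : ℤ)) k₂, intervalDegree k₁ k₂ A t * ψ t := by
  rw [hH.sum_degree_mul hA, Finset.sum_mul, ← sum_twinCoord v]
  rfl

/-- Resistances add at the cut vertex: the Laplacian of `H` is the sum of the two Laplacians, and
each sees only its own summand. -/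
lemma IsTwinGluing.isResistance (hH : IsTwinGluing H T v A) (hA : ∀ s, ¬ A s s)
    {D : V → V → ℝ} (hD : T.IsResistance D) (hg : IsIntervalResistance k₁ k₂ A g) :
    H.IsResistance fun x y =>
      D (twinBase v x) (twinBase v y) + g (twinCoord x) (twinCoord y) := by
  classical
  obtain ⟨hD0, a, ha⟩ := hD
  obtain ⟨hg0, b, hb⟩ := hg
  refine ⟨fun x => by simp [hD0, hg0],
    -- At `v` both Laplacians contribute a point mass. One of the two is always present, since every
    -- `z` lies over `v` or has coordinate `0`; the final `2` absorbs it.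
    fun x => Sum.elim a (fun _ => 0) x + (if twinBase v x = v then b (twinCoord x) else 0) -
      (if x = Sum.inl v then 2 else 0), fun x z => ?_⟩
  rw [hH.sum_adj hA]
  beta_reduce
  have h2 : (if twinBase v x = v then
      ∑ y : V ⊕ (Fin k₁ ⊕ Fin k₂), (if twinBase v y = v then
        (if A (twinCoord x) (twinCoord y) then
        D (twinBase v x) (twinBase v z) + g (twinCoord x) (twinCoord z) -
        (D (twinBase v y) (twinBase v z) + g (twinCoord y) (twinCoord z)) else 0) else 0)
        else 0) =
      if twinBase v x = v then
        b (twinCoord x) - 2 * (if twinCoord x = twinCoord z then 1 else 0) else 0 := by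
    by_cases hx : twinBase v x = v
    · rw [if_pos hx, if_pos hx, ← hb _ (twinCoord_mem x) _ (twinCoord_mem z),
        ← sum_twinCoord v fun t => if A (twinCoord x) t then
          g (twinCoord x) (twinCoord z) - g t (twinCoord z) else 0]
      refine Finset.sum_congr rfl fun y _ => ?_
      split_ifs with hy
      · rw [hx, hy]; ring
      · rfl
      · rfl
    · rw [if_neg hx, if_neg hx]
  rw [h2]
  rcases x with c | x
  · have h3 : ∑ d, (if T.Adj c d then
        D (twinBase v (Sum.inl c : V ⊕ (Fin k₁ ⊕ Fin k₂))) (twinBase v z) +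
          g (twinCoord (Sum.inl c : V ⊕ (Fin k₁ ⊕ Fin k₂))) (twinCoord z) -
        (D (twinBase v (Sum.inl d : V ⊕ (Fin k₁ ⊕ Fin k₂))) (twinBase v z) +
          g (twinCoord (Sum.inl d : V ⊕ (Fin k₁ ⊕ Fin k₂))) (twinCoord z)) else 0) =
        a c - 2 * if c = twinBase v z then 1 else 0 := by
      rw [← ha]
      refine Finset.sum_congr rfl fun d _ => ?_
      simp [twinBase, twinCoord]
    simp only [Sum.elim_inl]
    rw [h3]
    have hc0 : twinCoord (Sum.inl c : V ⊕ (Fin k₁ ⊕ Fin k₂)) = 0 := rfl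
    have hcb : twinBase v (Sum.inl c : V ⊕ (Fin k₁ ⊕ Fin k₂)) = c := rfl
    rw [hc0, hcb]
    by_cases hc : c = v
    · subst hc
      rcases z with e | z
      · have he0 : twinCoord (Sum.inl e : V ⊕ (Fin k₁ ⊕ Fin k₂)) = 0 := rfl
        have heb : twinBase c (Sum.inl e : V ⊕ (Fin k₁ ⊕ Fin k₂)) = e := rfl
        simp only [he0, heb, if_true, Sum.inl.injEq]
        ring
      · have hz0 : (0 : ℤ) ≠ twinCoord (Sum.inr z : V ⊕ (Fin k₁ ⊕ Fin k₂)) := by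
          rcases z with i | j <;> simp [twinCoord] <;> omega
        have hzb : twinBase c (Sum.inr z : V ⊕ (Fin k₁ ⊕ Fin k₂)) = c := rfl
        simp only [hzb, hz0, if_true, if_false, reduceCtorEq]
        ring
    · have hcz : c = twinBase v z ↔ Sum.inl c = z := by
        rcases z with e | z
        · simp [twinBase]
        · simpa [twinBase] using hc
      simp only [hc, if_false, Sum.inl.injEq, hcz]
      ring_nf
  · have hx : twinBase v (Sum.inr x : V ⊕ (Fin k₁ ⊕ Fin k₂)) = v := rfl
    have h4 : twinCoord (Sum.inr x : V ⊕ (Fin k₁ ⊕ Fin k₂)) = twinCoord z ↔ Sum.inr x = z := by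
      refine ⟨fun h => ?_, fun h => by rw [h]⟩
      rcases z with e | z
      · rcases x with i | j <;> simp [twinCoord] at h <;> omega
      · exact eq_of_twinBase_of_twinCoord (v := v) rfl h
    simp [hx, h4]

end Gluing

end SimpleGraph

namespace SimpleGraph

/-! ### The path and the cycle on an interval of integers -/

section IntervalGraphs

/-- Adjacency in the path on the integers. -/
def intervalPathAdj (s t : ℤ) : Prop := t = s + 1 ∨ s = t + 1

/-- Adjacency in the cycle obtained by closing up the interval `[-k₁, k₂]`. -/
def intervalCycleAdj (k₁ k₂ : ℕ) (s t : ℤ) : Prop :=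
  intervalPathAdj s t ∨ (s = -k₁ ∧ t = k₂) ∨ (s = k₂ ∧ t = -k₁)

/-- The effective resistance in a cycle of length `L` at displacement `u`. -/
noncomputable def cycleResistance (L : ℕ) (u : ℤ) : ℝ := |(u : ℝ)| * (L - |(u : ℝ)|) / L

open Classical in
lemma sum_intervalPathAdj {k₁ k₂ : ℕ} {s : ℤ} (hs : s ∈ Finset.Icc (-(k₁ : ℤ)) k₂) (φ : ℤ → ℝ) :
    ∑ t ∈ Finset.Icc (-(k₁ : ℤ)) k₂, (if intervalPathAdj s t then φ t else 0) =
      (if s < k₂ then φ (s + 1) else 0) + if -(k₁ : ℤ) < s then φ (s - 1) else 0 := by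
  have h1 : ∀ t, (if intervalPathAdj s t then φ t else 0) =
      (if t = s + 1 then φ t else 0) + if t = s - 1 then φ t else 0 := by
    intro t
    by_cases ha : t = s + 1
    · have hb : t ≠ s - 1 := by omega
      simp [intervalPathAdj, ha, show s + 1 ≠ s - 1 by omega]
    · by_cases hb : t = s - 1
      · simp [intervalPathAdj, hb, show s - 1 ≠ s + 1 by omega]
      · simp [intervalPathAdj, ha, hb, show s ≠ t + 1 by omega]
  simp_rw [h1]
  rw [Finset.sum_add_distrib, Finset.sum_ite_eq', Finset.sum_ite_eq']
  rw [Finset.mem_Icc] at hs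
  have h2 : s + 1 ∈ Finset.Icc (-(k₁ : ℤ)) k₂ ↔ s < k₂ := by rw [Finset.mem_Icc]; omega
  have h3 : s - 1 ∈ Finset.Icc (-(k₁ : ℤ)) k₂ ↔ -(k₁ : ℤ) < s := by rw [Finset.mem_Icc]; omega
  simp only [h2, h3]

-- With at least three vertices in the cycle, the successor and the predecessor of `s` are distinct.
open Classical in
lemma sum_intervalCycleAdj {k₁ k₂ : ℕ} (hk : 2 ≤ k₁ + k₂) {s : ℤ}
    (hs : s ∈ Finset.Icc (-(k₁ : ℤ)) k₂) (φ : ℤ → ℝ) :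
    ∑ t ∈ Finset.Icc (-(k₁ : ℤ)) k₂, (if intervalCycleAdj k₁ k₂ s t then φ t else 0) =
      φ (if s < k₂ then s + 1 else -k₁) + φ (if -(k₁ : ℤ) < s then s - 1 else k₂) := by
  rw [Finset.mem_Icc] at hs
  set n : ℤ := if s < k₂ then s + 1 else -k₁ with hn
  set p : ℤ := if -(k₁ : ℤ) < s then s - 1 else k₂ with hp
  have hnp : n ≠ p := by
    rw [hn, hp]; split_ifs <;> omega
  have hnI : n ∈ Finset.Icc (-(k₁ : ℤ)) k₂ := by
    rw [Finset.mem_Icc, hn]; split_ifs <;> omega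
  have hpI : p ∈ Finset.Icc (-(k₁ : ℤ)) k₂ := by
    rw [Finset.mem_Icc, hp]; split_ifs <;> omega
  have h1 : ∀ t ∈ Finset.Icc (-(k₁ : ℤ)) k₂, (if intervalCycleAdj k₁ k₂ s t then φ t else 0) =
      (if t = n then φ t else 0) + if t = p then φ t else 0 := by
    intro t ht
    rw [Finset.mem_Icc] at ht
    have hiff : intervalCycleAdj k₁ k₂ s t ↔ t = n ∨ t = p := by
      rw [intervalCycleAdj, intervalPathAdj, hn, hp]
      split_ifs <;> omega
    rw [if_congr hiff rfl rfl]
    by_cases ha : t = n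
    · have hb : t ≠ p := fun h => hnp (ha.symm.trans h)
      simp [ha, hnp]
    · simp [ha]
  rw [Finset.sum_congr rfl h1, Finset.sum_add_distrib, Finset.sum_ite_eq', Finset.sum_ite_eq',
    if_pos hnI, if_pos hpI]

lemma isIntervalResistance_path (k₁ k₂ : ℕ) :
    IsIntervalResistance k₁ k₂ intervalPathAdj fun s t => |(s : ℝ) - t| := by
  refine ⟨fun s => by simp, fun s => 2 - (if s < k₂ then 1 else 0) -
    (if -(k₁ : ℤ) < s then 1 else 0), fun s hs z hz => ?_⟩
  rw [sum_intervalPathAdj hs]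
  rw [Finset.mem_Icc] at hs hz
  have key : (if s < k₂ then |s - z| - |s + 1 - z| else 0) +
      (if -(k₁ : ℤ) < s then |s - z| - |s - 1 - z| else 0) =
      2 - (if s < k₂ then 1 else 0) - (if -(k₁ : ℤ) < s then 1 else 0) -
        2 * if s = z then 1 else 0 := by
    grind
  have := congrArg (Int.cast : ℤ → ℝ) key
  push_cast at this ⊢
  exact this

/-- Away from `0` this is the constant second difference of a quadratic, with a kink at `0`. The
formula takes equal values at displacements differing by `L`, so wrapped neighbours cause no change.
-/
lemma cycleResistance_step {L : ℕ} (hL : 0 < L) {u n p : ℤ} (hu : |u| < L)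
    (hn : n = u + 1 ∨ n = u + 1 - L) (hp : p = u - 1 ∨ p = u - 1 + L)
    (hn' : |n| < L) (hp' : |p| < L) :
    cycleResistance L u - cycleResistance L n + (cycleResistance L u - cycleResistance L p) =
      2 / L - 2 * if u = 0 then 1 else 0 := by
  have hL0 : (L : ℝ) ≠ 0 := by exact_mod_cast hL.ne'
  have key : |u| * (L - |u|) - |n| * (L - |n|) + (|u| * (L - |u|) - |p| * (L - |p|)) =
      2 - 2 * L * if u = 0 then 1 else 0 := by
    rw [abs_lt] at hu hn' hp'
    rcases lt_trichotomy u 0 with h | h | h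
    · have h1 : |n| * (L - |n|) = (-u - 1) * (L - (-u - 1)) := by
        rcases hn with rfl | rfl
        · rw [abs_of_nonpos (by omega)]; ring
        · exact absurd hn'.1 (by omega)
      have h2 : |p| * (L - |p|) = (-u + 1) * (L - (-u + 1)) := by
        rcases hp with rfl | rfl
        · rw [abs_of_nonpos (by omega)]; ring
        · rw [abs_of_nonneg (by omega)]; ring
      rw [h1, h2, abs_of_neg h, if_neg h.ne]
      ring
    · have h1 : |n| * (L - |n|) = L - 1 := by
        rcases hn with rfl | rfl
        · simp [h]
        · rw [abs_of_nonpos (by omega), h]; ring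
      have h2 : |p| * (L - |p|) = L - 1 := by
        rcases hp with rfl | rfl
        · simp [h]
        · rw [abs_of_nonneg (by omega), h]; ring
      rw [h1, h2, h]
      simp
      ring
    · have h1 : |n| * (L - |n|) = (u + 1) * (L - (u + 1)) := by
        rcases hn with rfl | rfl
        · rw [abs_of_nonneg (by omega)]
        · rw [abs_of_nonpos (by omega)]; ring
      have h2 : |p| * (L - |p|) = (u - 1) * (L - (u - 1)) := by
        rcases hp with rfl | rfl
        · rw [abs_of_nonneg (by omega)]
        · exact absurd hp'.2 (by omega)
      rw [h1, h2, abs_of_pos h, if_neg h.ne']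
      ring
  have key' := congrArg (Int.cast : ℤ → ℝ) key
  push_cast at key'
  unfold cycleResistance
  field_simp
  linarith

lemma isIntervalResistance_cycle {k₁ k₂ : ℕ} (hk : 2 ≤ k₁ + k₂) :
    IsIntervalResistance k₁ k₂ (intervalCycleAdj k₁ k₂)
      fun s t => cycleResistance (k₁ + k₂ + 1) (s - t) := by
  refine ⟨fun s => by simp [cycleResistance], fun _ => 2 / (k₁ + k₂ + 1 : ℕ), fun s hs z hz => ?_⟩
  rw [sum_intervalCycleAdj hk hs]
  rw [Finset.mem_Icc] at hs hz
  rw [cycleResistance_step (Nat.succ_pos _)]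
  · simp only [sub_eq_zero, Nat.succ_eq_add_one]
  · rw [abs_lt]; omega
  · split_ifs <;> omega
  · split_ifs <;> omega
  · rw [abs_lt]; split_ifs <;> omega
  · rw [abs_lt]; split_ifs <;> omega

lemma cycleResistance_nonneg {L : ℕ} {u : ℤ} (hu : |u| ≤ L) : 0 ≤ cycleResistance L u := by
  have : |(u : ℝ)| ≤ L := by exact_mod_cast hu
  exact div_nonneg (mul_nonneg (abs_nonneg _) (by linarith)) L.cast_nonneg

lemma not_intervalPathAdj_self (s : ℤ) : ¬ intervalPathAdj s s := by
  unfold intervalPathAdj; omega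

lemma not_intervalCycleAdj_self {k₁ k₂ : ℕ} (hk : 2 ≤ k₁ + k₂) (s : ℤ) :
    ¬ intervalCycleAdj k₁ k₂ s s := by
  unfold intervalCycleAdj intervalPathAdj; omega

lemma intervalDegree_pos_of_adj {k₁ k₂ : ℕ} {A : ℤ → ℤ → Prop} {s t : ℤ}
    (ht : t ∈ Finset.Icc (-(k₁ : ℤ)) k₂) (h : A s t) : 0 < intervalDegree k₁ k₂ A s := by
  classical
  exact Finset.sum_pos' (fun _ _ => by split_ifs <;> simp) ⟨t, ht, by simp [h]⟩

lemma intervalDegree_nonneg (k₁ k₂ : ℕ) (A : ℤ → ℤ → Prop) (s : ℤ) :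
    0 ≤ intervalDegree k₁ k₂ A s := by
  classical
  exact Finset.sum_nonneg fun _ _ => by split_ifs <;> simp

lemma intervalDegree_path_pos {k₁ k₂ : ℕ} (hk : 2 ≤ k₁ + k₂) {s : ℤ}
    (hs : s ∈ Finset.Icc (-(k₁ : ℤ)) k₂) : 0 < intervalDegree k₁ k₂ intervalPathAdj s := by
  rw [Finset.mem_Icc] at hs
  by_cases h : s < k₂
  · exact intervalDegree_pos_of_adj (t := s + 1) (by rw [Finset.mem_Icc]; omega) (Or.inl rfl)
  · exact intervalDegree_pos_of_adj (t := s - 1) (by rw [Finset.mem_Icc]; omega)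
      (Or.inr (by omega))

lemma intervalDegree_mono (k₁ k₂ : ℕ) {A B : ℤ → ℤ → Prop} {s : ℤ} (h : ∀ t, A s t → B s t) :
    intervalDegree k₁ k₂ A s ≤ intervalDegree k₁ k₂ B s := by
  classical
  refine Finset.sum_le_sum fun t _ => ?_
  by_cases ha : A s t
  · rw [if_pos ha, if_pos (h t ha)]
  · rw [if_neg ha]; split_ifs <;> simp

lemma intervalDegree_path_le_cycle (k₁ k₂ : ℕ) (s : ℤ) :
    intervalDegree k₁ k₂ intervalPathAdj s ≤
      intervalDegree k₁ k₂ (intervalCycleAdj k₁ k₂) s :=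
  intervalDegree_mono k₁ k₂ fun _ => Or.inl

lemma sum_intervalDegree_path_lt_cycle {k₁ k₂ : ℕ} (hk : 2 ≤ k₁ + k₂) :
    ∑ s ∈ Finset.Icc (-(k₁ : ℤ)) k₂, intervalDegree k₁ k₂ intervalPathAdj s <
      ∑ s ∈ Finset.Icc (-(k₁ : ℤ)) k₂, intervalDegree k₁ k₂ (intervalCycleAdj k₁ k₂) s := by
  classical
  have hmem : (k₂ : ℤ) ∈ Finset.Icc (-(k₁ : ℤ)) k₂ := by rw [Finset.mem_Icc]; omega
  -- At the endpoint `k₂` the path gives at most one neighbour and the cycle gives two.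
  refine Finset.sum_lt_sum (fun s _ => intervalDegree_path_le_cycle k₁ k₂ s) ⟨k₂, hmem, ?_⟩
  have h1 := sum_intervalPathAdj hmem fun _ => 1
  have h2 := sum_intervalCycleAdj hk hmem fun _ => 1
  rw [intervalDegree, intervalDegree, h1, h2]
  rw [if_neg (lt_irrefl _)]
  split_ifs <;> norm_num

end IntervalGraphs

/-! ### The twin-path graphs as gluings -/

section TwinGraphs

variable {V : Type*} {k₁ k₂ : ℕ} (T : SimpleGraph V) (v : V)

lemma twinBase_twinPath₁ (i : Fin (k₁ + 1)) : twinBase v (twinPath₁ v k₁ k₂ i) = v := by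
  refine Fin.cases ?_ (fun i => ?_) i <;> simp [twinPath₁, twinBase]

lemma twinBase_twinPath₂ (i : Fin (k₂ + 1)) : twinBase v (twinPath₂ v k₁ k₂ i) = v := by
  refine Fin.cases ?_ (fun i => ?_) i <;> simp [twinPath₂, twinBase]

lemma twinCoord_twinPath₁ (i : Fin (k₁ + 1)) : twinCoord (twinPath₁ v k₁ k₂ i) = -(i : ℤ) := by
  refine Fin.cases ?_ (fun i => ?_) i <;> simp [twinPath₁, twinCoord]

lemma twinCoord_twinPath₂ (i : Fin (k₂ + 1)) : twinCoord (twinPath₂ v k₁ k₂ i) = (i : ℤ) := by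
  refine Fin.cases ?_ (fun i => ?_) i <;> simp [twinPath₂, twinCoord]

lemma eq_twinPath₁_iff (x : V ⊕ (Fin k₁ ⊕ Fin k₂)) (i : Fin (k₁ + 1)) :
    twinPath₁ v k₁ k₂ i = x ↔ twinBase v x = v ∧ twinCoord x = -(i : ℤ) := by
  refine ⟨fun h => h ▸ ⟨twinBase_twinPath₁ v i, twinCoord_twinPath₁ v i⟩, fun h => ?_⟩
  exact eq_of_twinBase_of_twinCoord (v := v) (by rw [twinBase_twinPath₁, h.1])
    (by rw [twinCoord_twinPath₁, h.2])

lemma eq_twinPath₂_iff (x : V ⊕ (Fin k₁ ⊕ Fin k₂)) (i : Fin (k₂ + 1)) :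
    twinPath₂ v k₁ k₂ i = x ↔ twinBase v x = v ∧ twinCoord x = (i : ℤ) := by
  refine ⟨fun h => h ▸ ⟨twinBase_twinPath₂ v i, twinCoord_twinPath₂ v i⟩, fun h => ?_⟩
  exact eq_of_twinBase_of_twinCoord (v := v) (by rw [twinBase_twinPath₂, h.1])
    (by rw [twinCoord_twinPath₂, h.2])

lemma map_twinPath₁_adj (x y : V ⊕ (Fin k₁ ⊕ Fin k₂)) :
    ((pathGraph (k₁ + 1)).map (twinPath₁ v k₁ k₂)).Adj x y ↔
      twinBase v x = v ∧ twinBase v y = v ∧ intervalPathAdj (twinCoord x) (twinCoord y) ∧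
        twinCoord x ≤ 0 ∧ twinCoord y ≤ 0 := by
  rw [map_adj']
  simp only [pathGraph_adj, eq_twinPath₁_iff, intervalPathAdj]
  constructor
  · rintro ⟨hne, i, j, hij, ⟨hx, hxi⟩, hy, hyj⟩
    refine ⟨hx, hy, ?_⟩
    omega
  · rintro ⟨hx, hy, hadj, hx0, hy0⟩
    have h1 := Finset.mem_Icc.mp (twinCoord_mem x)
    have h2 := Finset.mem_Icc.mp (twinCoord_mem y)
    refine ⟨?_, ⟨(-twinCoord x).toNat, by omega⟩, ⟨(-twinCoord y).toNat, by omega⟩, ?_,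
      ⟨hx, ?_⟩, hy, ?_⟩
    · rintro rfl; omega
    all_goals simp only; omega

lemma map_twinPath₂_adj (x y : V ⊕ (Fin k₁ ⊕ Fin k₂)) :
    ((pathGraph (k₂ + 1)).map (twinPath₂ v k₁ k₂)).Adj x y ↔
      twinBase v x = v ∧ twinBase v y = v ∧ intervalPathAdj (twinCoord x) (twinCoord y) ∧
        0 ≤ twinCoord x ∧ 0 ≤ twinCoord y := by
  rw [map_adj']
  simp only [pathGraph_adj, eq_twinPath₂_iff, intervalPathAdj]
  constructor
  · rintro ⟨hne, i, j, hij, ⟨hx, hxi⟩, hy, hyj⟩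
    refine ⟨hx, hy, ?_⟩
    omega
  · rintro ⟨hx, hy, hadj, hx0, hy0⟩
    have h1 := Finset.mem_Icc.mp (twinCoord_mem x)
    have h2 := Finset.mem_Icc.mp (twinCoord_mem y)
    refine ⟨?_, ⟨(twinCoord x).toNat, by omega⟩, ⟨(twinCoord y).toNat, by omega⟩, ?_,
      ⟨hx, ?_⟩, hy, ?_⟩
    · rintro rfl; omega
    all_goals simp only; omega

lemma map_inl_adj (x y : V ⊕ (Fin k₁ ⊕ Fin k₂)) :
    (T.map (Sum.inl : V → V ⊕ (Fin k₁ ⊕ Fin k₂))).Adj x y ↔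
      ∃ a b, x = Sum.inl a ∧ y = Sum.inl b ∧ T.Adj a b := by
  rw [map_adj']
  constructor
  · rintro ⟨-, a, b, h, rfl, rfl⟩
    exact ⟨a, b, rfl, rfl, h⟩
  · rintro ⟨a, b, rfl, rfl, h⟩
    exact ⟨by simpa using h.ne, a, b, h, rfl, rfl⟩

/-- Consecutive integers lie on the same side of `0`, so the two half-paths together make up the
whole interval path. -/
lemma isTwinGluing_twinTilde : IsTwinGluing (T.twinTilde v k₁ k₂) T v intervalPathAdj := by
  intro x y
  rw [twinTilde, sup_adj, sup_adj, map_inl_adj, map_twinPath₁_adj, map_twinPath₂_adj, or_assoc]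
  refine or_congr Iff.rfl ⟨?_, ?_⟩
  · rintro (h | h) <;> exact ⟨h.1, h.2.1, h.2.2.1⟩
  · rintro ⟨hx, hy, h⟩
    have h' := h
    unfold intervalPathAdj at h'
    by_cases h0 : twinCoord x ≤ 0 ∧ twinCoord y ≤ 0
    · exact Or.inl ⟨hx, hy, h, h0⟩
    · exact Or.inr ⟨hx, hy, h, by omega⟩

lemma isTwinGluing_twinHat (hk : 2 ≤ k₁ + k₂) :
    IsTwinGluing (T.twinHat v k₁ k₂) T v (intervalCycleAdj k₁ k₂) := by
  intro x y
  rw [twinHat, sup_adj, isTwinGluing_twinTilde T v x y, edge_adj, or_assoc]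
  refine or_congr Iff.rfl ?_
  rw [eq_comm (a := x), eq_comm (a := y), eq_comm (a := x), eq_comm (a := y)]
  rw [eq_twinPath₁_iff, eq_twinPath₂_iff, eq_twinPath₁_iff, eq_twinPath₂_iff]
  simp only [Fin.val_last, intervalCycleAdj]
  constructor
  · rintro (h | ⟨⟨⟨hx, hx'⟩, hy, hy'⟩ | ⟨⟨hx, hx'⟩, hy, hy'⟩, -⟩)
    · exact ⟨h.1, h.2.1, Or.inl h.2.2⟩
    · exact ⟨hx, hy, Or.inr (Or.inl ⟨hx', hy'⟩)⟩
    · exact ⟨hx, hy, Or.inr (Or.inr ⟨hx', hy'⟩)⟩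
  · rintro ⟨hx, hy, h | h | h⟩
    · exact Or.inl ⟨hx, hy, h⟩
    · refine Or.inr ⟨Or.inl ⟨⟨hx, h.1⟩, hy, h.2⟩, ?_⟩
      rintro rfl; omega
    · refine Or.inr ⟨Or.inr ⟨⟨hx, h.1⟩, hy, h.2⟩, ?_⟩
      rintro rfl; omega

end TwinGraphs

end SimpleGraph

namespace SimpleGraph

/-! ### Kemeny's constant of a gluing -/

section KemenyOfGluing

variable {V : Type*} {k₁ k₂ : ℕ} [Fintype V] {H : SimpleGraph (V ⊕ (Fin k₁ ⊕ Fin k₂))}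
  {T : SimpleGraph V} {v : V} {A : ℤ → ℤ → Prop} {g : ℤ → ℤ → ℝ}

open Classical in
/-- Kemeny's constant of a tree glued to a graph on an interval. -/
lemma IsTwinGluing.exists_isKemenyConstant [Nontrivial V] (hH : IsTwinGluing H T v A)
    (hA : ∀ s, ¬ A s s) (hT : T.IsTree) (hg : IsIntervalResistance k₁ k₂ A g)
    (hd : ∀ s ∈ Finset.Icc (-(k₁ : ℤ)) k₂, 0 < intervalDegree k₁ k₂ A s) :
    ∃ κ : ℝ≥0, H.IsKemenyConstant κ ∧
      (κ : ℝ) = (∑ a, ∑ b, (T.degree a : ℝ) * T.degree b * T.dist a b +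
        2 * (∑ t ∈ Finset.Icc (-(k₁ : ℤ)) k₂, intervalDegree k₁ k₂ A t) *
          (∑ a, (T.degree a : ℝ) * T.dist a v) +
        (∑ a, (T.degree a : ℝ)) *
          (∑ t ∈ Finset.Icc (-(k₁ : ℤ)) k₂, intervalDegree k₁ k₂ A t * (g t 0 + g 0 t)) +
        ∑ s ∈ Finset.Icc (-(k₁ : ℤ)) k₂, ∑ t ∈ Finset.Icc (-(k₁ : ℤ)) k₂,
          intervalDegree k₁ k₂ A s * intervalDegree k₁ k₂ A t * g s t) /
      (2 * (∑ a, (T.degree a : ℝ) +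
        ∑ t ∈ Finset.Icc (-(k₁ : ℤ)) k₂, intervalDegree k₁ k₂ A t)) := by
  have hdeg : ∀ x, 0 < H.degree x := by
    intro x
    have h : (0 : ℝ) < H.degree x := by
      rw [hH.degree_eq hA]
      rcases x with a | x
      · refine add_pos_of_pos_of_nonneg ?_ ?_
        · rw [Sum.elim_inl]
          exact_mod_cast hT.connected.preconnected.degree_pos_of_nontrivial a
        · split_ifs
          · exact intervalDegree_nonneg _ _ _ _
          · exact le_rfl
      · have hx : twinBase v (Sum.inr x : V ⊕ (Fin k₁ ⊕ Fin k₂)) = v := rfl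
        rw [if_pos hx, Sum.elim_inr, zero_add]
        exact hd _ (twinCoord_mem _)
    exact_mod_cast h
  obtain ⟨κ, hκ, hval⟩ :=
    (hH.isResistance hA hT.isResistance_dist hg).exists_isKemenyConstant hdeg
  refine ⟨κ, hκ, hval.trans ?_⟩
  congr 1
  · set p := ∑ t ∈ Finset.Icc (-(k₁ : ℤ)) k₂, intervalDegree k₁ k₂ A t
    -- The resistance is a base term plus a coordinate term, so the numerator splits in two. In the
    -- base term all the interval's degree mass sits at `v`; in the coordinate term all of the
    -- tree's sits at `0`.
    have hbase : ∑ x, (H.degree x : ℝ) * ∑ y, (H.degree y : ℝ) *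
        T.dist (twinBase v x) (twinBase v y) =
        ∑ a, ∑ b, (T.degree a : ℝ) * T.degree b * T.dist a b +
          2 * p * ∑ a, (T.degree a : ℝ) * T.dist a v := by
      simp_rw [fun a => hH.sum_degree_mul_base hA fun b => (T.dist a b : ℝ)]
      rw [hH.sum_degree_mul_base hA fun a =>
        ∑ b, (T.degree b : ℝ) * T.dist a b + p * T.dist a v]
      simp only [mul_add, Finset.sum_add_distrib, dist_self, T.dist_comm (u := v), Nat.cast_zero,
        mul_zero, add_zero, mul_left_comm _ p]
      simp only [← Finset.mul_sum, mul_assoc]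
      ring
    have hcoord : ∑ x, (H.degree x : ℝ) * ∑ y, (H.degree y : ℝ) *
        g (twinCoord x) (twinCoord y) = (∑ a, (T.degree a : ℝ)) *
          (∑ t ∈ Finset.Icc (-(k₁ : ℤ)) k₂, intervalDegree k₁ k₂ A t * (g t 0 + g 0 t)) +
        ∑ s ∈ Finset.Icc (-(k₁ : ℤ)) k₂, ∑ t ∈ Finset.Icc (-(k₁ : ℤ)) k₂,
          intervalDegree k₁ k₂ A s * intervalDegree k₁ k₂ A t * g s t := by
      set M := ∑ a, (T.degree a : ℝ) with hM
      simp_rw [fun s => hH.sum_degree_mul_coord hA fun t => g s t, ← hM]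
      rw [hH.sum_degree_mul_coord hA fun s => M * g s 0 +
        ∑ t ∈ Finset.Icc (-(k₁ : ℤ)) k₂, intervalDegree k₁ k₂ A t * g s t, ← hM]
      simp only [mul_add, Finset.sum_add_distrib, hg.1, mul_zero, zero_add, mul_left_comm _ M]
      simp only [← Finset.mul_sum, mul_assoc]
      ring
    rw [add_assoc, ← hcoord, ← hbase, ← Finset.sum_add_distrib]
    refine Finset.sum_congr rfl fun x _ => ?_
    rw [← mul_add, ← Finset.sum_add_distrib, Finset.mul_sum]
    exact Finset.sum_congr rfl fun y _ => by ring
  · have := hH.sum_degree_mul_base hA fun _ => (1 : ℝ)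
    simp only [mul_one] at this
    rw [this]

end KemenyOfGluing

/-! ### A cubic lower bound from a geodesic -/

section Eccentricity

/-- The double sum is `1² + ⋯ + α²`: passing to `α + 1` adds `(α + 1)²`. -/
lemma sum_min_ge (α : ℕ) :
    α ^ 3 ≤ 3 * ∑ s ∈ Finset.range (α + 1), ∑ t ∈ Finset.range (α + 1), min s t := by
  induction α with
  | zero => simp
  | succ α ih =>
    have h1 : ∑ s ∈ Finset.range (α + 1), min s (α + 1) = ∑ s ∈ Finset.range (α + 1), s :=
      Finset.sum_congr rfl fun s hs => min_eq_left (Finset.mem_range.mp hs).le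
    have h2 : ∑ s ∈ Finset.range (α + 1), min (α + 1) s = ∑ s ∈ Finset.range (α + 1), s :=
      Finset.sum_congr rfl fun s hs => min_eq_right (Finset.mem_range.mp hs).le
    have h3 := Finset.sum_range_id_mul_two (α + 1)
    rw [Nat.add_sub_cancel] at h3
    rw [Finset.sum_range_succ]
    simp_rw [fun s => Finset.sum_range_succ (fun t => min s t) (α + 1)]
    rw [Finset.sum_add_distrib, h1, h2, min_self]
    nlinarith

variable {V : Type*} {G : SimpleGraph V}

lemma Connected.exists_geodesic (hG : G.Connected) (v x : V) :
    ∃ p : ℕ → V, (∀ s ≤ G.dist v x, G.dist v (p s) = s) ∧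
      ∀ s t, s ≤ t → G.dist (p s) (p t) ≤ t - s := by
  obtain ⟨p, hp⟩ := hG.exists_walk_length_eq_dist v x
  have hle : ∀ s d, G.dist (p.getVert s) (p.getVert (s + d)) ≤ d := by
    intro s d
    induction d with
    | zero => simp
    | succ d ih =>
      have h1 : G.dist (p.getVert (s + d)) (p.getVert (s + d + 1)) ≤ 1 := by
        by_cases h : s + d < p.length
        · exact (dist_eq_one_iff_adj.mpr (p.adj_getVert_succ h)).le
        · rw [p.getVert_of_length_le (by omega), p.getVert_of_length_le (by omega)]
          simp
      have h2 := hG.dist_triangle (u := p.getVert s) (v := p.getVert (s + d))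
        (w := p.getVert (s + d + 1))
      rw [← add_assoc]
      omega
  have hle' : ∀ s t, s ≤ t → G.dist (p.getVert s) (p.getVert t) ≤ t - s := by
    intro s t hst
    have := hle s (t - s)
    rwa [Nat.add_sub_cancel' hst] at this
  refine ⟨p.getVert, fun s hs => ?_, hle'⟩
  have h1 := hle' 0 s (Nat.zero_le s)
  have h2 := hle' s p.length (hp ▸ hs)
  rw [p.getVert_zero] at h1
  rw [p.getVert_length] at h2
  have h3 := hG.dist_triangle (u := v) (v := p.getVert s) (w := x)
  omega

open Classical in
/-- The degree-weighted sum of Gromov products at `v` is at least cubic in the distance from `v`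
to any vertex. -/
lemma Connected.cube_dist_le_sum_gromov [Fintype V] [Nontrivial V] (hG : G.Connected) (v x : V) :
    2 / 3 * (G.dist v x : ℝ) ^ 3 ≤ ∑ a, ∑ b, (G.degree a : ℝ) * G.degree b *
      ((G.dist a v : ℝ) + G.dist b v - G.dist a b) := by
  obtain ⟨p, hp, hpd⟩ := hG.exists_geodesic v x
  set α := G.dist v x
  set f : V → V → ℝ := fun a b => (G.degree a : ℝ) * G.degree b *
      ((G.dist a v : ℝ) + G.dist b v - G.dist a b) with hf
  have hdeg : ∀ a, (1 : ℝ) ≤ G.degree a := fun a => by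
    exact_mod_cast hG.preconnected.degree_pos_of_nontrivial a
  have htri : ∀ a b, (0 : ℝ) ≤ (G.dist a v : ℝ) + G.dist b v - G.dist a b := by
    intro a b
    have := hG.dist_triangle (u := a) (v := v) (w := b)
    rw [G.dist_comm (u := v)] at this
    have : (G.dist a b : ℝ) ≤ G.dist a v + G.dist b v := by exact_mod_cast this
    linarith
  have hnn : ∀ a b, 0 ≤ f a b := fun a b =>
    mul_nonneg (mul_nonneg (Nat.cast_nonneg _) (Nat.cast_nonneg _)) (htri a b)
  have hlow : ∀ s ∈ Finset.range (α + 1), ∀ t ∈ Finset.range (α + 1),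
      2 * ((min s t : ℕ) : ℝ) ≤ f (p s) (p t) := by
    intro s hs t ht
    rw [Finset.mem_range] at hs ht
    -- On the geodesic, `s + t - |s - t| = 2 min(s,t)`.
    have h1 : 2 * ((min s t : ℕ) : ℝ) ≤
        (G.dist (p s) v : ℝ) + G.dist (p t) v - G.dist (p s) (p t) := by
      rw [G.dist_comm (u := p s) (v := v), G.dist_comm (u := p t) (v := v), hp s (by omega),
        hp t (by omega)]
      have : 2 * min s t + G.dist (p s) (p t) ≤ s + t := by
        rcases le_total s t with h | h
        · have := hpd s t h
          omega
        · have := hpd t s h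
          rw [G.dist_comm] at this
          omega
      have : (2 * (min s t : ℕ) + G.dist (p s) (p t) : ℝ) ≤ s + t := by exact_mod_cast this
      linarith
    refine h1.trans (le_mul_of_one_le_left (htri _ _) ?_)
    exact one_le_mul_of_one_le_of_one_le (hdeg _) (hdeg _)
  have hinj : Set.InjOn p (Finset.range (α + 1) : Set ℕ) := by
    intro s hs t ht h
    simp only [Finset.coe_range, Set.mem_Iio] at hs ht
    rw [← hp s (by omega), ← hp t (by omega), h]
  have hsub : ∀ φ : V → ℝ, (∀ a, 0 ≤ φ a) →
      ∑ s ∈ Finset.range (α + 1), φ (p s) ≤ ∑ a, φ a := by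
    intro φ hφ
    rw [← Finset.sum_image (f := φ) hinj]
    exact Finset.sum_le_univ_sum_of_nonneg hφ
  have hmin : (α : ℝ) ^ 3 ≤ 3 * ∑ s ∈ Finset.range (α + 1), ∑ t ∈ Finset.range (α + 1),
      ((min s t : ℕ) : ℝ) := by exact_mod_cast sum_min_ge α
  calc 2 / 3 * (α : ℝ) ^ 3 ≤ 2 * ∑ s ∈ Finset.range (α + 1), ∑ t ∈ Finset.range (α + 1),
        ((min s t : ℕ) : ℝ) := by linarith
    _ = ∑ s ∈ Finset.range (α + 1), ∑ t ∈ Finset.range (α + 1), 2 * ((min s t : ℕ) : ℝ) := by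
        simp_rw [Finset.mul_sum]
    _ ≤ ∑ s ∈ Finset.range (α + 1), ∑ t ∈ Finset.range (α + 1), f (p s) (p t) :=
        Finset.sum_le_sum fun s hs => Finset.sum_le_sum fun t ht => hlow s hs t ht
    _ ≤ ∑ s ∈ Finset.range (α + 1), ∑ b, f (p s) b :=
        Finset.sum_le_sum fun s _ => hsub _ (hnn _)
    _ ≤ ∑ a, ∑ b, f a b := hsub _ fun a => Finset.sum_nonneg fun b _ => hnn a b

lemma exists_dist_eq_toNat_eccent [Finite V] (G : SimpleGraph V) (v : V) :
    ∃ x, G.dist v x = (G.eccent v).toNat := by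
  obtain ⟨x, hx⟩ := G.exists_edist_eq_eccent_of_finite v
  exact ⟨x, by rw [← hx]; rfl⟩

end Eccentricity

/-! ### Comparing the two constants -/

section Paradoxical

variable {V : Type*} [Fintype V] {T : SimpleGraph V}

open Classical in
lemma IsTree.sum_degree (hT : T.IsTree) :
    ∑ a, (T.degree a : ℝ) = 2 * (Fintype.card V - 1 : ℝ) := by
  have h1 := T.sum_degrees_eq_twice_card_edges
  have h2 := hT.card_edgeFinset
  have h3 : ∑ a, (T.degree a : ℝ) = 2 * (T.edgeFinset.card : ℝ) := by exact_mod_cast h1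
  rw [h3, ← h2]
  push_cast
  ring

/-- After cross-multiplication the gain is `(q - p)(2Mμ - F)`, as the `2pqμ` terms cancel. The loss
`(M + q)(FP + M μP)` is bounded using `M ≤ 2n` and `1 ≤ n`, and the cycle's nonnegative terms are
discarded. -/
lemma kemeny_quotient_lt {p q μP FP μC FC M n μ F δ : ℝ} (hp0 : 0 ≤ p) (hpq : p < q)
    (hμP : 0 ≤ μP) (hFP : 0 ≤ FP) (hμC : 0 ≤ μC) (hFC : 0 ≤ FC) (hM0 : 0 < M) (hn : 1 ≤ n)
    (hMn : M ≤ 2 * n) (hδ : 2 / 3 * δ ≤ 2 * M * μ - F)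
    (h : 3 / 2 * ((2 + q) * (FP + 2 * μP)) * n ^ 2 < δ * (q - p)) :
    (F + 2 * p * μ + M * μP + FP) / (2 * (M + p)) <
      (F + 2 * q * μ + M * μC + FC) / (2 * (M + q)) := by
  have hq0 : 0 < q := hp0.trans_lt hpq
  have hbound : (M + q) * (FP + M * μP) ≤ ((2 + q) * (FP + 2 * μP)) * n ^ 2 := by
    have h1 : M + q ≤ (2 + q) * n := by
      have := le_mul_of_one_le_right hq0.le hn
      linarith
    have h2 : FP + M * μP ≤ (FP + 2 * μP) * n := by
      have h3 := le_mul_of_one_le_right hFP hn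
      have h4 := mul_le_mul_of_nonneg_right hMn hμP
      linarith
    calc (M + q) * (FP + M * μP) ≤ ((2 + q) * n) * ((FP + 2 * μP) * n) :=
          mul_le_mul h1 h2 (by positivity) (by positivity)
      _ = _ := by ring
  have hgap : (q - p) * (2 / 3 * δ) ≤ (q - p) * (2 * M * μ - F) :=
    mul_le_mul_of_nonneg_left hδ (sub_pos.mpr hpq).le
  have hextra : 0 ≤ (M + p) * (M * μC + FC) := by positivity
  rw [div_lt_div_iff₀ (by linarith) (by linarith)]
  linarith

/-- A tree with a vertex far from `v`, relative to its order, is paradoxical. -/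
lemma exists_isParadoxicalAt_of_sq_lt_cube {k₁ k₂ : ℕ} (hk : 2 ≤ k₁ + k₂) :
    ∃ C : ℝ, 0 ≤ C ∧ ∀ {V : Type*} [Fintype V] {T : SimpleGraph V} (_ : T.IsTree)
      (_ : Nontrivial V) (v x : V), C * (Fintype.card V : ℝ) ^ 2 < (T.dist v x : ℝ) ^ 3 →
      T.IsParadoxicalAt v k₁ k₂ := by
  classical
  set I := Finset.Icc (-(k₁ : ℤ)) k₂
  set dP := intervalDegree k₁ k₂ intervalPathAdj
  set dC := intervalDegree k₁ k₂ (intervalCycleAdj k₁ k₂)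
  set p := ∑ t ∈ I, dP t
  set q := ∑ t ∈ I, dC t
  set gP : ℤ → ℤ → ℝ := fun s t => |(s : ℝ) - t|
  set gC : ℤ → ℤ → ℝ := fun s t => cycleResistance (k₁ + k₂ + 1) (s - t)
  set μP := ∑ t ∈ I, dP t * (gP t 0 + gP 0 t)
  set FP := ∑ s ∈ I, ∑ t ∈ I, dP s * dP t * gP s t
  have hpq : p < q := sum_intervalDegree_path_lt_cycle hk
  have hdP : ∀ t, 0 ≤ dP t := intervalDegree_nonneg _ _ _
  have hdC : ∀ t, 0 ≤ dC t := intervalDegree_nonneg _ _ _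
  have hp0 : 0 ≤ p := Finset.sum_nonneg fun t _ => hdP t
  have hμP : 0 ≤ μP := Finset.sum_nonneg fun t _ =>
    mul_nonneg (hdP t) (add_nonneg (abs_nonneg _) (abs_nonneg _))
  have hFP : 0 ≤ FP := Finset.sum_nonneg fun s _ => Finset.sum_nonneg fun t _ =>
    mul_nonneg (mul_nonneg (hdP s) (hdP t)) (abs_nonneg _)
  have hgC : ∀ s ∈ I, ∀ t ∈ I, 0 ≤ gC s t := by
    intro s hs t ht
    rw [Finset.mem_Icc] at hs ht
    refine cycleResistance_nonneg ?_
    rw [abs_le]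
    push_cast
    omega
  have h0I : (0 : ℤ) ∈ I := by rw [Finset.mem_Icc]; omega
  -- `D` depends only on `k₁` and `k₂`, so one constant serves all trees. The factor `3 / 2` inverts
  -- the `2 / 3` of the geodesic bound.
  set D := 3 / 2 * ((2 + q) * (FP + 2 * μP)) with hD
  have hD0 : 0 ≤ D := by
    have : 0 ≤ q := hp0.trans hpq.le
    positivity
  refine ⟨D / (q - p), div_nonneg hD0 (sub_pos.mpr hpq).le, ?_⟩
  intro V _ T hT _ v x hx
  rw [div_mul_eq_mul_div, div_lt_iff₀ (sub_pos.mpr hpq)] at hx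
  obtain ⟨a, ha, haval⟩ := (isTwinGluing_twinHat T v hk).exists_isKemenyConstant
    (not_intervalCycleAdj_self hk) hT (isIntervalResistance_cycle hk) fun s hs =>
      (intervalDegree_path_pos hk hs).trans_le (intervalDegree_path_le_cycle k₁ k₂ s)
  obtain ⟨b, hb, hbval⟩ :=
    (isTwinGluing_twinTilde (k₁ := k₁) (k₂ := k₂) T v).exists_isKemenyConstant
    not_intervalPathAdj_self hT (isIntervalResistance_path k₁ k₂) fun s hs =>
      intervalDegree_path_pos hk hs
  refine ⟨a, b, ha, hb, ?_⟩
  rw [gt_iff_lt, ← NNReal.coe_lt_coe, haval, hbval]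
  set M := ∑ c, (T.degree c : ℝ) with hM
  set μ := ∑ c, (T.degree c : ℝ) * T.dist c v with hμ
  set F := ∑ c, ∑ d, (T.degree c : ℝ) * T.degree d * T.dist c d with hF
  set μC := ∑ t ∈ I, dC t * (gC t 0 + gC 0 t)
  set FC := ∑ s ∈ I, ∑ t ∈ I, dC s * dC t * gC s t
  have hμC : 0 ≤ μC := Finset.sum_nonneg fun t ht =>
    mul_nonneg (hdC t) (add_nonneg (hgC _ ht _ h0I) (hgC _ h0I _ ht))
  have hFC : 0 ≤ FC := Finset.sum_nonneg fun s hs => Finset.sum_nonneg fun t ht =>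
    mul_nonneg (mul_nonneg (hdC s) (hdC t)) (hgC s hs t ht)
  have hcard : (2 : ℝ) ≤ Fintype.card V := by exact_mod_cast Fintype.one_lt_card (α := V)
  have hMn : M = 2 * (Fintype.card V - 1 : ℝ) := hT.sum_degree
  have hgromov : 2 / 3 * (T.dist v x : ℝ) ^ 3 ≤ 2 * M * μ - F := by
    refine (hT.connected.cube_dist_le_sum_gromov v x).trans_eq ?_
    have h1 : ∀ c d, (T.degree c : ℝ) * T.degree d *
        ((T.dist c v : ℝ) + T.dist d v - T.dist c d) =
        ((T.degree c : ℝ) * T.dist c v) * T.degree d + T.degree c * (T.degree d * T.dist d v) -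
          T.degree c * T.degree d * T.dist c d := fun c d => by ring
    simp_rw [h1, Finset.sum_sub_distrib, Finset.sum_add_distrib, ← Finset.mul_sum,
      ← Finset.sum_mul]
    ring
  set n : ℝ := (Fintype.card V : ℝ)
  have hM0 : 0 < M := by rw [hMn]; linarith
  have hM2 : M ≤ 2 * n := by rw [hMn]; linarith
  have hq0 : 0 < q := hp0.trans_lt hpq
  change (F + 2 * p * μ + M * μP + FP) / (2 * (M + p)) <
    (F + 2 * q * μ + M * μC + FC) / (2 * (M + q))
  exact kemeny_quotient_lt hp0 hpq hμP hFP hμC hFC hM0 (by linarith) hM2 hgromov hx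

end Paradoxical

/-! ### Orders of the trees, and the conclusion -/

section Growth

lemma card_eq_card_add_one_of_existsUnique_notMem_range {V W : Type*} [Fintype V] [Fintype W]
    (f : V ↪ W) {x : W} (hx : ∀ y, y ∉ Set.range f ↔ y = x) :
    Fintype.card W = Fintype.card V + 1 := by
  classical
  have h : (Finset.univ : Finset W) = insert x (Finset.univ.map f) := by
    ext y
    have := hx y
    simp only [Finset.mem_univ, Finset.mem_insert, Finset.mem_map, true_and, true_iff]
    by_cases hy : y ∈ Set.range f
    · exact Or.inr hy
    · exact Or.inl (this.mp hy)
  have hnot : x ∉ Finset.univ.map f := by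
    have := (hx x).mpr rfl
    simpa using this
  rw [← Finset.card_univ, h, Finset.card_insert_of_notMem hnot, Finset.card_map, Finset.card_univ]

/-- Either move adds exactly one vertex. Beyond the trees being trees, this is all that the growth
rule contributes. -/
lemma IsGrowingTreeSequence.card_eq {V : ℕ → Type*} [∀ n, Fintype (V n)]
    {T : ∀ n, SimpleGraph (V n)} {v : ∀ n, V n} (hT : IsGrowingTreeSequence T v) {n : ℕ}
    (hn : 1 ≤ n) : Fintype.card (V n) = n := by
  induction n, hn using Nat.le_induction with
  | base => exact Fintype.card_eq_one_iff.mpr ⟨v 1, hT.start⟩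
  | succ n hn ih =>
    obtain ⟨f, -, ⟨x, -, hx, -⟩ | ⟨x, -, -, -, hx, -⟩⟩ := hT.grow n hn <;>
    rw [card_eq_card_add_one_of_existsUnique_notMem_range f hx, ih]

end Growth

end SimpleGraph

theorem corollary5p1 {V : ℕ → Type*} [∀ n, Fintype (V n)]
    (T : ∀ n, SimpleGraph (V n)) (v : ∀ n, V n)
    (hT : SimpleGraph.IsGrowingTreeSequence T v)
    (hα : (fun n : ℕ => (n : ℝ) ^ (2 / 3 : ℝ)) =o[atTop]
      (fun n : ℕ => (((T n).eccent (v n)).toNat : ℝ))) :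
    SimpleGraph.AsymptoticallyParadoxical T v := by
  intro k₁ k₂ hk
  obtain ⟨C, hC0, hC⟩ := SimpleGraph.exists_isParadoxicalAt_of_sq_lt_cube hk
  -- With this constant, cubing gives `(C + 1) n² ≤ α³`; the extra `1` makes the inequality with `C`
  -- strict and keeps the denominator positive.
  have hc : 0 < 1 / (C + 1) := by positivity
  obtain ⟨N, hN⟩ := eventually_atTop.mp (hα.def hc)
  -- The bound `2` excludes the one-vertex tree, whose only vertex has degree `0`.
  refine ⟨max N 2, by positivity, fun n hn => ?_⟩
  have hn2 : 2 ≤ n := (le_max_right N 2).trans hn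
  have hcard := hT.card_eq (n := n) (by omega)
  obtain ⟨x, hx⟩ := (T n).exists_dist_eq_toNat_eccent (v n)
  have h := hN n ((le_max_left N 2).trans hn)
  have : Nontrivial (V n) := Fintype.one_lt_card_iff_nontrivial.mp (by omega)
  refine hC (hT.isTree n (by omega)) this (v n) x ?_
  rw [← hx, Real.norm_of_nonneg (by positivity), Real.norm_of_nonneg (by positivity)] at h
  rw [hcard]
  set α : ℝ := ((T n).dist (v n) x : ℝ)
  have hnpos : (0 : ℝ) < n := by exact_mod_cast (show 0 < n by omega)
  have h3 : ((n : ℝ) ^ (2 / 3 : ℝ)) ^ 3 = (n : ℝ) ^ 2 := by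
    rw [← Real.rpow_natCast, ← Real.rpow_mul hnpos.le, ← Real.rpow_natCast]
    norm_num
  have h4 := pow_le_pow_left₀ (by positivity) h 3
  rw [h3, mul_pow] at h4
  have h5 : (1 / (C + 1)) ^ 3 ≤ 1 / (C + 1) := by
    refine pow_le_of_le_one hc.le ?_ three_ne_zero
    rw [div_le_one (by positivity)]
    linarith
  have hα0 : 0 ≤ α ^ 3 := by positivity
  have h6 : (n : ℝ) ^ 2 ≤ 1 / (C + 1) * α ^ 3 := h4.trans (mul_le_mul_of_nonneg_right h5 hα0)
  rw [div_mul_eq_mul_div, one_mul, le_div_iff₀ (by positivity)] at h6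
  have h7 : (0 : ℝ) < n ^ 2 := by positivity
  linarith
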